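/- Let $\Pi=\{z\in\mathbb C:\operatorname{Im}z>0\}$ and let the Pick class $\mathcal P$ be the set of analytic functions $f$ on $\Pi$ with $\operatorname{Im}f\ge 0$ on $\Pi$. A function $f\in\mathcal P$ is called meromorphic at $x\in\mathbb R$ if it extends to a function meromorphic at $x$, i.e. if there are a neighbourhood $U$ of $x$ in $\mathbb C$ and a meromorphic function on $U$, analytic on $U\setminus\{x\}$, that equals $f$ on $U\cap\Pi$; then $L_k(f,x)$ denotes the $k$-th Laurent coefficient of this extension at $x$. Let $x\in\mathbb R$, let $n\ge 1$ be an integer and let $a=(a^{-1},a^0,\dots,a^n)\in\mathbb C^{n+2}$ (upper indices, not powers) with $a^{-1}\le 0$ (in particular real) and $\operatorname{Im}a^0\ge 0$. Problem $\partial CF\mathcal P$: find $f\in\mathcal P$, meromorphic at $x$, such that $$L_k(f,x)=a^k,\qquad k=-1,0,1,\dots,n.$$ The problem is solvable if it has at least one solution. Put $\rho(a)=\inf\{k: 0\le k\le n,\ \operatorname{Im}a^k\ne 0\}$, with $\rho(a)=\infty$ if all $a^k$ are real. For $m\geq 1$ with $2m-1\le n$ let $H_m(a)=[a^{i+j-1}]_{i,j=1}^m$;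 $H_0(a)$ is the empty matrix, which counts as positive definite. Write $H>0$ for "$H$ is positive definite" and $H\ge 0$ for "$H$ is positive semidefinite". $H_m(a)$, $m\ge1$, is called SE-minimally positive if $H_m(a)\ge 0$ and, for every $\varepsilon>0$, $H_m(a)-\operatorname{diag}\{0,\dots,0,\varepsilon\}$ is not positive semidefinite. **Theorem.** (1) If $\rho(a)$ is finite and odd, then Problem $\partial CF\mathcal P$ has no solution. (2) If $\rho(a)=2m$ for some non-negative integer $m$, then the problem is solvable if and only if $H_m(a)>0$ and $\operatorname{Im}a^{2m}>0$. (3) If $\rho(a)=\infty$ and $n=2m-1$ is odd, then the problem is solvable if and only if $H_m(a)$ is either positive definite or SE-minimally positive. Moreover, the problem has a unique solution if and only if $H_m(a)$ is SE-minimally positive. (4) If $\rho(a)=\infty$ and $n=2m$ is even, then the problem is solvable if and only if either $H_m(a)$ is positive definite, or $H_m(a)$ is SE-minimally positive and $$a^{n}=\begin{bmatrix}a^m & a^{m+1}&\cdots&a^{m+r-1}\end{bmatrix}H_r(a)^{-1}\begin{bmatrix}a^{m+1}\\ a^{m+2}\\ \vdots\\ a^{m+r}\end{bmatrix},\qquad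 r=\operatorname{rank}H_m(a)\tag{1.2}$$ (for $r=0$ the right-hand side is $0$). Moreover, the problem has a unique solution if and only if $H_m(a)$ is SE-minimally positive and $a^n$ satisfies (1.2). -/

import Mathlib

open Filter Topology
open scoped ComplexOrder UpperHalfPlane

/-- The Pick class: holomorphic functions on the open upper half plane whose imaginary part is
nonnegative everywhere. -/
structure IsPick (f : ℍ → ℂ) : Prop where
  differentiableOn : DifferentiableOn ℂ (fun z => f (UpperHalfPlane.ofComplex z)) {z | 0 < z.im}
  im_nonneg : ∀ z : ℍ, 0 ≤ (f z).im

/-- `c k`, `k ∈ ℤ`, are the Laurent coefficients of `F` at `x`: only finitely many `c k` with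
`k < 0` are nonzero, and `F z = ∑ c k * (z - x) ^ k` on a deleted neighbourhood of `x`. -/
def IsLaurentExpansionAt (F : ℂ → ℂ) (x : ℂ) (c : ℤ → ℂ) : Prop :=
  ∃ N : ℕ, (∀ k : ℤ, k < -(N : ℤ) → c k = 0) ∧
    ∀ᶠ z in 𝓝[≠] x, HasSum (fun j : ℕ => c ((j : ℤ) - N) * (z - x) ^ ((j : ℤ) - N)) (F z)

/-- `f` is a solution of the boundary Carathéodory-Fejér problem at the real point `x` with data
`a (-1), a 0, …, a n` (the other values of `a` play no role): `f` is in the Pick class, it extends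
to a function `F` meromorphic at `x` (that is, `F` agrees with `f` on the part in the upper half
plane of a neighbourhood of `x`), and the `k`-th Laurent coefficient at `x` is `a k` for
`k = -1, 0, …, n`. -/
def IsSolution (x : ℝ) (n : ℕ) (a : ℤ → ℂ) (f : ℍ → ℂ) : Prop :=
  IsPick f ∧ ∃ F : ℂ → ℂ, MeromorphicAt F (x : ℂ) ∧
    (∀ᶠ z in 𝓝 (x : ℂ), ∀ hz : 0 < z.im, F z = f ⟨z, hz⟩) ∧
    ∃ c : ℤ → ℂ, IsLaurentExpansionAt F (x : ℂ) c ∧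
      ∀ k : ℤ, -1 ≤ k → k ≤ (n : ℤ) → c k = a k

/-- The least index `k` with `0 ≤ k ≤ n` such that `a k` is not real; `⊤` if there is none. -/
noncomputable def rho (n : ℕ) (a : ℤ → ℂ) : ℕ∞ :=
  ⨅ k ∈ {k : ℕ | k ≤ n ∧ (a (k : ℤ)).im ≠ 0}, (k : ℕ∞)

/-- The `m × m` Hankel matrix `[a (i + j - 1)]`, `1 ≤ i, j ≤ m` (`Fin m` counts from `0`). -/
def hankel (m : ℕ) (a : ℤ → ℂ) : Matrix (Fin m) (Fin m) ℂ :=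
  Matrix.of fun i j => a (((i : ℕ) : ℤ) + ((j : ℕ) : ℤ) + 1)

/-- South-east-minimal positivity: `H` is positive semidefinite, and it is no longer so when any
`ε > 0` is subtracted from its last diagonal entry. -/
def IsSEMinimallyPositive {m : ℕ} (H : Matrix (Fin m) (Fin m) ℂ) : Prop :=
  H.PosSemidef ∧ ∀ ε : ℝ, 0 < ε →
    ¬ (H - Matrix.diagonal fun i : Fin m => if (i : ℕ) + 1 = m then (ε : ℂ) else 0).PosSemidef

/-- The condition
`a (2m) = [a m, …, a (m + r - 1)] * (H_r)⁻¹ * [a (m + 1), …, a (m + r)]ᵀ`, `r = rank H_m`. -/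
def LastCoeffCondition (m : ℕ) (a : ℤ → ℂ) : Prop :=
  a (2 * (m : ℤ)) =
    (fun i : Fin (hankel m a).rank => a ((m : ℤ) + ((i : ℕ) : ℤ))) ⬝ᵥ
      Matrix.mulVec (hankel (hankel m a).rank a)⁻¹
        (fun i : Fin (hankel m a).rank => a ((m : ℤ) + 1 + ((i : ℕ) : ℤ)))

/-! A Pick function that is meromorphic at `x` has at most a simple pole there, and deleting the
polar part keeps it Pick. Subtracting the prescribed pole is therefore a bijection onto Pick
functions analytic at `x` with `n + 1` prescribed Taylor coefficients
(`isSolution_iff_isRegularSolution`).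

The engine is the Julia reduction `f ↦ -1/(f - α₀) + 1/(α₁(z - x))`, for `α₀` real and `α₁ > 0`.
Julia's inequality, the boundary limit of Schwarz–Pick, says that the reduced function is again
Pick, and every augmentation of a Pick function is Pick. So solutions with `N + 2` coefficients
correspond bijectively to solutions with `N` coefficients (`isRegularSolution_julia_iff`). On the
data, the Hankel matrix becomes, up to congruence by an invertible Toeplitz matrix, the block sum of
`1/α₁` and the smaller Hankel matrix (`IsJuliaPair.hankelSeries_eq`). The congruence also respects
SE-minimality, and the imaginary part of the first non-real coefficient is only divided by `α₁²`.

Induction leaves few terminal cases. A non-real `α₁` over a real `α₀` is impossible. If `Im α₀ > 0`,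
any further coefficients can be interpolated. If `α₁ = 0`, Julia's inequality forces a constant.
With at most one real coefficient left, there are several solutions. Positive definite matrices with
real data end in the last case, SE-minimal ones in the constant case, whence uniqueness. In the
SE-minimal case all Taylor coefficients of the solution form a Hankel matrix of finite rank with a
triangular factorization, from which the formula for the coefficient of index `2m` is read off. -/

open PowerSeries in
/-- The Taylor series at `x` of a function, as a formal power series. -/
noncomputable def taylor (F : ℂ → ℂ) (x : ℂ) : ℂ⟦X⟧ :=
  PowerSeries.mk fun n => iteratedDeriv n F x / n.factorial

/-! ### Taylor expansion at a point, as an operation compatible with sums and products. -/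

section Taylor

open PowerSeries

variable {F G : ℂ → ℂ} {x : ℂ}

theorem coeff_taylor (n : ℕ) : coeff n (taylor F x) = iteratedDeriv n F x / n.factorial := by
  simp [taylor]

theorem coeff_zero_taylor : coeff 0 (taylor F x) = F x := by simp [taylor]

theorem coeff_one_taylor : coeff 1 (taylor F x) = deriv F x := by simp [taylor]

theorem taylor_congr (h : F =ᶠ[𝓝 x] G) : taylor F x = taylor G x := by
  ext n
  rw [coeff_taylor, coeff_taylor, h.iteratedDeriv_eq n]

theorem taylor_add (hF : AnalyticAt ℂ F x) (hG : AnalyticAt ℂ G x) :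
    taylor (fun z => F z + G z) x = taylor F x + taylor G x := by
  ext n
  rw [map_add, coeff_taylor, coeff_taylor, coeff_taylor,
    iteratedDeriv_fun_add hF.contDiffAt hG.contDiffAt, add_div]

theorem taylor_neg : taylor (fun z => -F z) x = -taylor F x := by
  ext n
  rw [map_neg, coeff_taylor, coeff_taylor, iteratedDeriv_fun_neg, neg_div]

theorem taylor_sub (hF : AnalyticAt ℂ F x) (hG : AnalyticAt ℂ G x) :
    taylor (fun z => F z - G z) x = taylor F x - taylor G x := by
  simp only [sub_eq_add_neg]
  rw [taylor_add hF hG.fun_neg, taylor_neg]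

theorem taylor_mul (hF : AnalyticAt ℂ F x) (hG : AnalyticAt ℂ G x) :
    taylor (fun z => F z * G z) x = taylor F x * taylor G x := by
  ext n
  rw [coeff_mul, coeff_taylor, iteratedDeriv_fun_mul hF.contDiffAt hG.contDiffAt,
    Finset.Nat.sum_antidiagonal_eq_sum_range_succ
      (fun i j => coeff i (taylor F x) * coeff j (taylor G x)), Finset.sum_div]
  refine Finset.sum_congr rfl fun i hi => ?_
  have hi' : i ≤ n := Nat.lt_succ_iff.1 (Finset.mem_range.1 hi)
  have h0 : ∀ k : ℕ, (k.factorial : ℂ) ≠ 0 := fun k => by exact_mod_cast k.factorial_ne_zero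
  have h1 : (n.choose i : ℂ) * i.factorial * (n - i).factorial = n.factorial := by
    exact_mod_cast Nat.choose_mul_factorial_mul_factorial hi'
  rw [coeff_taylor, coeff_taylor, ← h1]
  have h2 : (n.choose i : ℂ) ≠ 0 := by exact_mod_cast (Nat.choose_pos hi').ne'
  field_simp [h0, h2]

theorem taylor_const (c : ℂ) : taylor (fun _ => c) x = C c := by
  ext n
  rw [coeff_taylor, iteratedDeriv_const, coeff_C]
  rcases n with _ | n <;> simp

theorem taylor_pow (hF : AnalyticAt ℂ F x) (n : ℕ) :
    taylor (fun z => F z ^ n) x = taylor F x ^ n := by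
  induction n with
  | zero => simpa using taylor_const (x := x) 1
  | succ n ih => simp only [pow_succ]; rw [taylor_mul (hF.fun_pow n) hF, ih]

theorem taylor_sub_self : taylor (fun z => z - x) x = X := by
  ext n
  rw [coeff_taylor, coeff_X]
  rcases n with _ | _ | n
  · simp
  · simp
  · rw [iteratedDeriv_succ']
    have : deriv (fun z : ℂ => z - x) = fun _ => 1 := by ext; simp
    rw [this, iteratedDeriv_const]
    simp

theorem hasFPowerSeriesAt_taylor (hF : AnalyticAt ℂ F x) :
    HasFPowerSeriesAt F (FormalMultilinearSeries.ofScalars ℂ fun n => coeff n (taylor F x)) x := by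
  simpa [coeff_taylor] using hF.hasFPowerSeriesAt

theorem eventually_hasSum_taylor (hF : AnalyticAt ℂ F x) :
    ∀ᶠ z in 𝓝 x, HasSum (fun n : ℕ => coeff n (taylor F x) * (z - x) ^ n) (F z) := by
  have h := hasFPowerSeriesAt_iff'.1 (hasFPowerSeriesAt_taylor hF)
  simpa [mul_comm] using h

theorem hasFPowerSeriesAt_of_eventually_hasSum {c : ℕ → ℂ}
    (h : ∀ᶠ z in 𝓝 x, HasSum (fun n : ℕ => c n * (z - x) ^ n) (F z)) :
    HasFPowerSeriesAt F (FormalMultilinearSeries.ofScalars ℂ c) x := by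
  rw [hasFPowerSeriesAt_iff']
  simpa [mul_comm] using h

theorem taylor_eq_mk_of_eventually_hasSum {c : ℕ → ℂ}
    (h : ∀ᶠ z in 𝓝 x, HasSum (fun n : ℕ => c n * (z - x) ^ n) (F z)) :
    taylor F x = PowerSeries.mk c := by
  have h1 := hasFPowerSeriesAt_of_eventually_hasSum h
  have h2 := hasFPowerSeriesAt_taylor h1.analyticAt
  have h3 := FormalMultilinearSeries.ofScalars_series_injective ℂ ℂ
    (h2.eq_formalMultilinearSeries h1)
  ext n
  simpa using congrFun h3 n

theorem AnalyticAt.dslope_self (hF : AnalyticAt ℂ F x) : AnalyticAt ℂ (dslope F x) x :=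
  (hF.hasFPowerSeriesAt.has_fpower_series_dslope_fslope).analyticAt

theorem taylor_eq_C_add_X_mul (hF : AnalyticAt ℂ F x) :
    taylor F x = C (F x) + X * taylor (dslope F x) x := by
  have h : (fun z => F x + (z - x) * dslope F x z) = F := by
    ext z
    have := sub_smul_dslope F x z
    rw [smul_eq_mul] at this
    rw [this]; ring
  have hx : AnalyticAt ℂ (fun z : ℂ => z - x) x := by fun_prop
  conv_lhs => rw [← h]
  rw [taylor_add analyticAt_const (hx.fun_mul hF.dslope_self), taylor_const,
    taylor_mul hx hF.dslope_self, taylor_sub_self]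

theorem taylor_polynomial_eval (p : Polynomial ℂ) (hF : AnalyticAt ℂ F x) :
    taylor (fun z => p.eval (F z)) x = Polynomial.aeval (taylor F x) p := by
  have hp : ∀ p : Polynomial ℂ, AnalyticAt ℂ (fun z => p.eval (F z)) x := fun p => by
    have h1 : AnalyticAt ℂ (fun z => p.eval z) (F x) :=
      Differentiable.analyticAt p.differentiable _
    exact h1.comp hF
  induction p using Polynomial.induction_on' with
  | add p q h1 h2 =>
    simp only [Polynomial.eval_add, map_add]
    rw [taylor_add (hp p) (hp q), h1, h2]
  | monomial n a =>
    simp only [Polynomial.eval_monomial, Polynomial.aeval_monomial]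
    rw [taylor_mul analyticAt_const (hF.fun_pow n), taylor_const, taylor_pow hF]
    rfl

end Taylor

/-! ### Schwarz–Pick in the half plane. -/

section SchwarzPick

open Complex ComplexConjugate

/-- This identity bounds the Cayley quotient by `1` and converts the contraction form of
Schwarz–Pick into the Pick-matrix form. -/
theorem normSq_sub_conj_sub_normSq_sub (a b : ℂ) :
    normSq (a - conj b) - normSq (a - b) = 4 * a.im * b.im := by
  simp only [normSq_apply, sub_re, sub_im, conj_re, conj_im]
  ring

theorem sub_conj_ne_zero {a b : ℂ} (ha : 0 < a.im) (hb : 0 < b.im) : a - conj b ≠ 0 := by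
  intro h
  have := congrArg Complex.im h
  simp at this
  linarith

/-- The Schwarz–Pick inequality for maps of the open upper half plane to itself. -/
theorem schwarz_pick_norm {φ : ℂ → ℂ} (hd : DifferentiableOn ℂ φ {z | 0 < z.im})
    (him : ∀ z, 0 < z.im → 0 < (φ z).im) {z w : ℂ} (hz : 0 < z.im) (hw : 0 < w.im) :
    ‖φ z - φ w‖ * ‖z - conj w‖ ≤ ‖z - w‖ * ‖φ z - conj (φ w)‖ := by
  -- Cayley map of the unit disc onto the half plane with `c 0 = w`. Conjugating `φ` by it, and by
  -- the corresponding map at `φ w`, gives a self-map of the disc fixing `0`, to which Schwarz's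
  -- lemma applies.
  set c : ℂ → ℂ := fun ζ => (w - conj w * ζ) / (1 - ζ) with hc
  have hball : ∀ ζ ∈ Metric.ball (0 : ℂ) 1, normSq ζ < 1 ∧ 1 - ζ ≠ 0 := by
    intro ζ hζ
    rw [mem_ball_zero_iff] at hζ
    refine ⟨?_, fun h => ?_⟩
    · rw [normSq_eq_norm_sq]; nlinarith [norm_nonneg ζ]
    · rw [← sub_eq_zero.1 h] at hζ; simp at hζ
  have hcim : ∀ ζ ∈ Metric.ball (0 : ℂ) 1, 0 < (c ζ).im := by
    intro ζ hζ
    obtain ⟨h1, h2⟩ := hball ζ hζ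
    have h3 : (c ζ).im = w.im * (1 - normSq ζ) / normSq (1 - ζ) := by
      simp only [hc, div_im, sub_re, sub_im, mul_re, mul_im, conj_re, conj_im, one_re, one_im]
      rw [← sub_div]
      congr 1
      simp only [normSq_apply]
      ring
    rw [h3]
    have := normSq_pos.2 h2
    have : 0 < 1 - normSq ζ := by linarith
    positivity
  have hcd : DifferentiableOn ℂ c (Metric.ball 0 1) := by
    intro ζ hζ
    have h2 := (hball ζ hζ).2
    exact DifferentiableAt.differentiableWithinAt (by fun_prop (disch := exact h2))
  set G : ℂ → ℂ := fun ζ => (φ (c ζ) - φ w) / (φ (c ζ) - conj (φ w)) with hG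
  have hφc : DifferentiableOn ℂ (fun ζ => φ (c ζ)) (Metric.ball 0 1) :=
    hd.comp hcd hcim
  have hGd : DifferentiableOn ℂ G (Metric.ball 0 1) := by
    refine (hφc.sub_const _).div (hφc.sub_const _) fun ζ hζ => ?_
    exact sub_conj_ne_zero (him _ (hcim ζ hζ)) (him _ hw)
  have hGle : ∀ a : ℂ, 0 < a.im → ‖(a - φ w) / (a - conj (φ w))‖ ≤ 1 := by
    intro a ha
    rw [norm_div, div_le_one (norm_pos_iff.2 (sub_conj_ne_zero ha (him _ hw)))]
    rw [← abs_norm, ← abs_norm (a - conj (φ w)), ← sq_le_sq, ← normSq_eq_norm_sq,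
      ← normSq_eq_norm_sq]
    have := normSq_sub_conj_sub_normSq_sub a (φ w)
    have := him _ hw
    have : 0 < 4 * a.im * (φ w).im := by positivity
    linarith
  have hG0 : G 0 = 0 := by simp [hG, hc]
  set ζ : ℂ := (z - w) / (z - conj w) with hζ
  have hzw := sub_conj_ne_zero hz hw
  have hww := sub_conj_ne_zero hw hw
  have hζ1 : ‖ζ‖ < 1 := by
    rw [hζ, norm_div, div_lt_one (norm_pos_iff.2 hzw)]
    rw [← abs_norm, ← abs_norm (z - conj w), ← sq_lt_sq, ← normSq_eq_norm_sq,
      ← normSq_eq_norm_sq]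
    have := normSq_sub_conj_sub_normSq_sub z w
    have : 0 < 4 * z.im * w.im := by positivity
    linarith
  have hcζ : c ζ = z := by
    have h2 := (hball ζ (by simpa using hζ1)).2
    simp only [hc]
    rw [div_eq_iff h2, hζ]
    field_simp
    ring
  have key := Complex.norm_le_norm_of_mapsTo_ball hGd
    (fun ζ hζ => mem_closedBall_zero_iff.2 (hGle _ (him _ (hcim ζ hζ)))) hG0 (z := ζ) (by simpa using hζ1)
  simp only [hG, hcζ] at key
  rw [norm_div, hζ, norm_div, div_le_div_iff₀
    (norm_pos_iff.2 (sub_conj_ne_zero (him _ hz) (him _ hw))) (norm_pos_iff.2 hzw)] at key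
  exact key

/-- The Schwarz–Pick inequality, in the form of the positivity of a `2 × 2` Pick matrix. -/
theorem schwarz_pick {φ : ℂ → ℂ} (hd : DifferentiableOn ℂ φ {z | 0 < z.im})
    (him : ∀ z, 0 < z.im → 0 ≤ (φ z).im) {z w : ℂ} (hz : 0 < z.im) (hw : 0 < w.im) :
    normSq (φ z - conj (φ w)) * (z.im * w.im) ≤ normSq (z - conj w) * ((φ z).im * (φ w).im) := by
  -- The shift by `ε * I` makes the imaginary part strictly positive; then `ε → 0`.
  have key : ∀ ε : ℝ, 0 < ε →
      normSq (φ z + ε * I - conj (φ w + ε * I)) * (z.im * w.im) ≤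
        normSq (z - conj w) * ((φ z + ε * I).im * (φ w + ε * I).im) := by
    intro ε hε
    have h := schwarz_pick_norm (φ := fun z => φ z + ε * I) (hd.add_const _)
      (fun z hz => by have := him z hz; simp; linarith) hz hw
    have h1 := pow_le_pow_left₀ (by positivity) h 2
    rw [mul_pow, mul_pow, ← normSq_eq_norm_sq, ← normSq_eq_norm_sq, ← normSq_eq_norm_sq,
      ← normSq_eq_norm_sq] at h1
    have h2 := normSq_sub_conj_sub_normSq_sub z w
    have h3 := normSq_sub_conj_sub_normSq_sub (φ z + ε * I) (φ w + ε * I)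
    linear_combination (1 / 4) * h1 - (normSq (φ z + ε * I - conj (φ w + ε * I)) / 4) * h2 +
      (normSq (z - conj w) / 4) * h3
  have hlim : ∀ g : ℝ → ℝ, Continuous g → Tendsto g (𝓝[>] 0) (𝓝 (g 0)) :=
    fun g hg => (hg.tendsto 0).mono_left nhdsWithin_le_nhds
  have h1 := hlim (fun ε => normSq (φ z + ε * I - conj (φ w + ε * I)) * (z.im * w.im))
    (by fun_prop)
  have h2 := hlim (fun ε => normSq (z - conj w) * ((φ z + ε * I).im * (φ w + ε * I).im))
    (by fun_prop)
  have := le_of_tendsto_of_tendsto h1 h2 (eventually_mem_nhdsWithin.mono fun ε hε => key ε hε)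
  simpa using this

end SchwarzPick

/-! ### Boundary derivative and Julia's inequality. -/

section Julia

open Complex ComplexConjugate

variable {φ F : ℂ → ℂ} {x : ℝ}

theorem tendsto_add_mul_nhdsGT (x : ℝ) (e : ℂ) :
    Tendsto (fun s : ℝ => (x : ℂ) + s * e) (𝓝[>] 0) (𝓝 (x : ℂ)) := by
  have : Continuous (fun s : ℝ => (x : ℂ) + s * e) := by fun_prop
  simpa using (this.tendsto 0).mono_left nhdsWithin_le_nhds

theorem tendsto_slope_im (hF : AnalyticAt ℂ F x)
    (hφF : ∀ᶠ z in 𝓝 (x : ℂ), 0 < z.im → F z = φ z) (h0 : (F x).im = 0) {e : ℂ} (he : 0 < e.im) :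
    Tendsto (fun s : ℝ => (φ (x + s * e)).im / s) (𝓝[>] 0) (𝓝 (deriv F x * e).im) := by
  have h1 : HasDerivAt F (deriv F x) ((x : ℂ) + ((0 : ℝ) : ℂ) * e) := by
    simpa using hF.differentiableAt.hasDerivAt
  have h2 : HasDerivAt (fun s : ℝ => (x : ℂ) + s * e) e 0 := by
    simpa using ((hasDerivAt_id (0 : ℝ)).ofReal_comp.mul_const e).const_add (x : ℂ)
  have h3 : HasDerivAt (fun s : ℝ => F (x + s * e)) (deriv F x * e) 0 := h1.comp (0 : ℝ) h2
  have h4 := h3.hasDerivWithinAt (s := Set.Ioi 0)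
  rw [hasDerivWithinAt_iff_tendsto_slope' (by simp)] at h4
  have h5 := (continuous_im.tendsto _).comp h4
  refine h5.congr' ?_
  filter_upwards [(tendsto_add_mul_nhdsGT x e).eventually hφF, self_mem_nhdsWithin] with s hs hs0
  have hs0' : (0 : ℝ) < s := hs0
  rw [← hs (by simp; positivity)]
  simp only [Function.comp_apply, slope_def_module, sub_zero, ofReal_zero, zero_mul, add_zero,
    Complex.smul_im, sub_im, h0]
  rw [smul_eq_mul]; ring

theorem im_deriv_mul_nonneg (him : ∀ z, 0 < z.im → 0 ≤ (φ z).im) (hF : AnalyticAt ℂ F x)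
    (hφF : ∀ᶠ z in 𝓝 (x : ℂ), 0 < z.im → F z = φ z) (h0 : (F x).im = 0) {e : ℂ} (he : 0 < e.im) :
    0 ≤ (deriv F x * e).im := by
  refine ge_of_tendsto (tendsto_slope_im hF hφF h0 he) ?_
  filter_upwards [self_mem_nhdsWithin] with s hs
  have hs0 : (0 : ℝ) < s := hs
  exact div_nonneg (him _ (by simp; positivity)) hs0.le

/-- A Pick function that is analytic and real at `x` has a real nonnegative derivative there. -/
theorem deriv_nonneg_of_pick (him : ∀ z, 0 < z.im → 0 ≤ (φ z).im) (hF : AnalyticAt ℂ F x)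
    (hφF : ∀ᶠ z in 𝓝 (x : ℂ), 0 < z.im → F z = φ z) (h0 : (F x).im = 0) :
    0 ≤ deriv F x := by
  have key : ∀ a b : ℝ, 0 < b → 0 ≤ (deriv F x).re * b + (deriv F x).im * a := by
    intro a b hb
    have := im_deriv_mul_nonneg him hF hφF h0 (e := ⟨a, b⟩) hb
    simpa [mul_im] using this
  set p := (deriv F x).re
  set q := (deriv F x).im
  have hp : 0 ≤ p := by simpa using key 0 1 one_pos
  have hq : q = 0 := by
    by_contra hq
    have hq2 : 0 < q ^ 2 := by positivity
    -- This direction makes the nonnegative quantity equal to `p - (p + 1) = -1`.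
    have := key (-(p + 1) / q) 1 one_pos
    have h2 : q * (-(p + 1) / q) = -(p + 1) := by field_simp
    rw [h2] at this
    linarith
  rw [Complex.le_def]
  exact ⟨hp, by simpa using hq.symm⟩

/-- Julia's inequality at a boundary point where the function is analytic and real. -/
theorem julia_inequality (hd : DifferentiableOn ℂ φ {z | 0 < z.im})
    (him : ∀ z, 0 < z.im → 0 ≤ (φ z).im) (hF : AnalyticAt ℂ F x)
    (hφF : ∀ᶠ z in 𝓝 (x : ℂ), 0 < z.im → F z = φ z) (h0 : (F x).im = 0) {z : ℂ} (hz : 0 < z.im) :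
    normSq (φ z - F x) * z.im ≤ normSq (z - x) * ((φ z).im * (deriv F x).re) := by
  -- Put `w = x + s * I` in `schwarz_pick`, divide by `s = Im w`, and let `s → 0`: the quotient `Im
  -- φ(w) / s` tends to the derivative.
  have hslope := tendsto_slope_im hF hφF h0 (e := I) (by simp)
  have hw := tendsto_add_mul_nhdsGT x I
  have hφ : Tendsto (fun s : ℝ => φ (x + s * I)) (𝓝[>] 0) (𝓝 (F x)) := by
    refine (hF.continuousAt.tendsto.comp hw).congr' ?_
    filter_upwards [hw.eventually hφF, self_mem_nhdsWithin] with s hs hs0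
    have hs0' : (0 : ℝ) < s := hs0
    exact hs (by simpa using hs0')
  have hl : Tendsto (fun s : ℝ => normSq (φ z - conj (φ (x + s * I))) * z.im) (𝓝[>] 0)
      (𝓝 (normSq (φ z - conj (F x)) * z.im)) := by
    refine Tendsto.mul_const _ ?_
    exact (continuous_normSq.tendsto _).comp
      (tendsto_const_nhds.sub ((continuous_conj.tendsto _).comp hφ))
  have hr : Tendsto (fun s : ℝ => normSq (z - conj (x + s * I)) *
      ((φ z).im * ((φ (x + s * I)).im / s))) (𝓝[>] 0)
      (𝓝 (normSq (z - conj (x : ℂ)) * ((φ z).im * (deriv F x * I).im))) := by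
    refine Tendsto.mul ?_ (hslope.const_mul _)
    exact (continuous_normSq.tendsto _).comp
      (tendsto_const_nhds.sub ((continuous_conj.tendsto _).comp hw))
  have h := le_of_tendsto_of_tendsto hl hr ?_
  · have hc : conj (F x) = F x := conj_eq_iff_im.2 h0
    simpa [hc] using h
  · filter_upwards [self_mem_nhdsWithin] with s hs
    have hs0 : (0 : ℝ) < s := hs
    have h := schwarz_pick hd him hz (w := x + s * I) (by simpa using hs0)
    have hi : ((x : ℂ) + s * I).im = s := by simp
    rw [hi] at h
    rw [← mul_le_mul_iff_left₀ hs0]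
    calc _ = normSq (φ z - conj (φ (x + s * I))) * (z.im * s) := by ring
      _ ≤ _ := h
      _ = _ := by field_simp

/-- The right-hand side of Julia's inequality vanishes. -/
theorem eq_const_of_deriv_eq_zero (hd : DifferentiableOn ℂ φ {z | 0 < z.im})
    (him : ∀ z, 0 < z.im → 0 ≤ (φ z).im) (hF : AnalyticAt ℂ F x)
    (hφF : ∀ᶠ z in 𝓝 (x : ℂ), 0 < z.im → F z = φ z) (h0 : (F x).im = 0)
    (h1 : deriv F x = 0) {z : ℂ} (hz : 0 < z.im) : φ z = F x := by
  have h := julia_inequality hd him hF hφF h0 hz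
  rw [h1] at h
  simp only [zero_re, mul_zero] at h
  have h2 := normSq_nonneg (φ z - F x)
  have h3 : normSq (φ z - F x) = 0 := by
    by_contra hne
    have : 0 < normSq (φ z - F x) := lt_of_le_of_ne h2 (Ne.symm hne)
    nlinarith
  exact sub_eq_zero.1 (normSq_eq_zero.1 h3)

/-- A Pick function with a real value in the half plane is constant. -/
theorem eq_const_of_im_eq_zero (hd : DifferentiableOn ℂ φ {z | 0 < z.im})
    (him : ∀ z, 0 < z.im → 0 ≤ (φ z).im) {w : ℂ} (hw : 0 < w.im) (h0 : (φ w).im = 0)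
    {z : ℂ} (hz : 0 < z.im) : φ z = φ w := by
  have h := schwarz_pick hd him hz hw
  rw [h0, conj_eq_iff_im.2 h0] at h
  simp only [mul_zero] at h
  have h2 := normSq_nonneg (φ z - φ w)
  have h3 : normSq (φ z - φ w) = 0 := by
    by_contra hne
    have : 0 < normSq (φ z - φ w) := lt_of_le_of_ne h2 (Ne.symm hne)
    have : 0 < z.im * w.im := by positivity
    nlinarith
  exact sub_eq_zero.1 (normSq_eq_zero.1 h3)

/-- Identity theorem: the points `x + s * I` lie in the half plane and accumulate at `x`. -/
theorem eventually_eq_of_eventually_upper {F G : ℂ → ℂ} (hF : AnalyticAt ℂ F x)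
    (hG : AnalyticAt ℂ G x) (h : ∀ᶠ z in 𝓝 (x : ℂ), 0 < z.im → F z = G z) : F =ᶠ[𝓝 (x : ℂ)] G := by
  refine (hF.frequently_eq_iff_eventually_eq hG).1 ?_
  have h1 : Tendsto (fun s : ℝ => (x : ℂ) + s * I) (𝓝[>] 0) (𝓝[≠] (x : ℂ)) := by
    refine tendsto_nhdsWithin_iff.2 ⟨tendsto_add_mul_nhdsGT x I, ?_⟩
    filter_upwards [self_mem_nhdsWithin] with s hs
    have hs0 : (0 : ℝ) < s := hs
    simp [hs0.ne']
  refine h1.frequently (Eventually.frequently ?_)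
  filter_upwards [(tendsto_add_mul_nhdsGT x I).eventually h, self_mem_nhdsWithin] with s hs hs0
  have hs0' : (0 : ℝ) < s := hs0
  exact hs (by simpa using hs0')

end Julia

/-! ### The Julia reduction of formal power series. -/

section JuliaPair

open PowerSeries

/-- Drop the constant term and divide by the variable. -/
noncomputable def PowerSeries.divX (U : ℂ⟦X⟧) : ℂ⟦X⟧ := PowerSeries.mk fun k => coeff (k + 1) U

@[simp]
theorem coeff_divX (U : ℂ⟦X⟧) (k : ℕ) : coeff k U.divX = coeff (k + 1) U := by
  simp [PowerSeries.divX]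

@[simp]
theorem constantCoeff_divX (U : ℂ⟦X⟧) : constantCoeff U.divX = coeff 1 U := by
  rw [← coeff_zero_eq_constantCoeff_apply, coeff_divX]

theorem eq_C_add_X_mul_divX (U : ℂ⟦X⟧) : U = C (coeff 0 U) + X * U.divX := by
  ext n
  rcases n with _ | n <;> simp

theorem divX_C_add_X_mul (c : ℂ) (U : ℂ⟦X⟧) : (C c + X * U).divX = U := by
  ext n
  simp

theorem taylor_dslope {F : ℂ → ℂ} {x : ℂ} (hF : AnalyticAt ℂ F x) :
    taylor (dslope F x) x = (taylor F x).divX := by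
  conv_rhs => rw [taylor_eq_C_add_X_mul hF]
  rw [divX_C_add_X_mul]

/-- The relation between the Taylor series of a function and the Taylor series of its Julia
reduction. -/
def IsJuliaPair (U V : ℂ⟦X⟧) : Prop :=
  U.divX * (1 - C (coeff 1 U) * (X * V)) = C (coeff 1 U)

/-- The Julia reduction of a power series. -/
noncomputable def juliaSeries (U : ℂ⟦X⟧) : ℂ⟦X⟧ := -(U.divX⁻¹).divX

/-- With `u = U.divX` and `u₁` its constant term, the reduction is `-1/(X u) + 1/(u₁ X) = -(1/u -
1/u₁)/X`, that is, minus the `divX` of `1/u`. Clearing denominators gives `IsJuliaPair`, which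
mentions no inverse. -/
theorem isJuliaPair_of_inv {U V W : ℂ⟦X⟧} (hW : U.divX * W = 1)
    (hV : V = -W.divX) : IsJuliaPair U V := by
  have h0 : coeff 1 U * coeff 0 W = 1 := by
    have := congrArg (coeff 0) hW
    simpa using this
  have h2 : W = C (coeff 0 W) - X * V := by
    rw [hV]
    conv_lhs => rw [eq_C_add_X_mul_divX W]
    ring
  have h3 : C (coeff 1 U) * C (coeff 0 W) = (1 : ℂ⟦X⟧) := by rw [← map_mul, h0, map_one]
  rw [IsJuliaPair]
  calc U.divX * (1 - C (coeff 1 U) * (X * V))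
      = U.divX * (C (coeff 1 U) * (C (coeff 0 W) - X * V)) := by rw [← h3]; ring
    _ = C (coeff 1 U) * (U.divX * W) := by rw [← h2]; ring
    _ = _ := by rw [hW, mul_one]

theorem isJuliaPair_juliaSeries {U : ℂ⟦X⟧} (h1 : coeff 1 U ≠ 0) :
    IsJuliaPair U (juliaSeries U) :=
  isJuliaPair_of_inv (PowerSeries.mul_inv_cancel _ (by simpa using h1)) rfl

/-- Combining the two relations gives `U.divX - A.divX = X * unit * (V - B)`. The order of agreement
grows by one through the factor `X` and by one more through `divX`. -/
theorem IsJuliaPair.coeff_eq_iff {U V A B : ℂ⟦X⟧} (hU : IsJuliaPair U V) (hA : IsJuliaPair A B)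
    (h1 : coeff 1 U = coeff 1 A) (hne : coeff 1 A ≠ 0) (h0 : coeff 0 U = coeff 0 A) (N : ℕ) :
    (∀ k < N + 2, coeff k U = coeff k A) ↔ ∀ k < N, coeff k V = coeff k B := by
  have hrel : C (coeff 1 A) * (U.divX - A.divX) =
      C (coeff 1 A) * (X * ((U.divX * A.divX) * (V - B))) := by
    rw [IsJuliaPair] at hU hA
    rw [h1] at hU
    linear_combination A.divX * hU - U.divX * hA
  have hC : (C (coeff 1 A) : ℂ⟦X⟧) ≠ 0 := by
    intro h
    exact hne (by simpa using congrArg (coeff 0) h)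
  have hrel2 := mul_left_cancel₀ hC hrel
  have hunit : IsUnit (U.divX * A.divX) := by
    rw [PowerSeries.isUnit_iff_constantCoeff, map_mul]
    simp [h1, hne]
  have e1 : (∀ k < N, coeff k V = coeff k B) ↔ X ^ N ∣ V - B := by
    simp [X_pow_dvd_iff, sub_eq_zero]
  have e2 : (∀ k < N + 2, coeff k U = coeff k A) ↔ X ^ (N + 1) ∣ U.divX - A.divX := by
    simp only [X_pow_dvd_iff, map_sub, sub_eq_zero, coeff_divX]
    constructor
    · intro h k hk; exact h _ (by omega)
    · intro h k hk
      rcases k with _ | k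
      · exact h0
      · exact h k (by omega)
  rw [e1, e2, hrel2, pow_succ', mul_dvd_mul_iff_left X_ne_zero, hunit.dvd_mul_left]

end JuliaPair

/-! ### Julia reduction of Pick functions analytic at the boundary point. -/

section RegularSolution

open Complex

theorem IsPick.of_differentiableOn {φ : ℂ → ℂ} (hd : DifferentiableOn ℂ φ {z | 0 < z.im})
    (him : ∀ z, 0 < z.im → 0 ≤ (φ z).im) : IsPick (fun z : ℍ => φ z) where
  differentiableOn := hd.congr fun z hz => by
    have hz' : 0 < z.im := hz
    simp [UpperHalfPlane.ofComplex_apply_of_im_pos hz']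
  im_nonneg z := him z z.im_pos

theorem isPick_const {c : ℂ} (hc : 0 ≤ c.im) : IsPick (fun _ => c) :=
  IsPick.of_differentiableOn (φ := fun _ => c) (differentiableOn_const _) fun _ _ => hc

theorem eventually_ofComplex {F : ℂ → ℂ} {f : ℍ → ℂ} {x : ℂ}
    (h : ∀ᶠ z in 𝓝 x, ∀ hz : 0 < z.im, F z = f ⟨z, hz⟩) :
    ∀ᶠ z in 𝓝 x, 0 < z.im → F z = f (UpperHalfPlane.ofComplex z) :=
  h.mono fun z hz hz0 => by
    rw [UpperHalfPlane.ofComplex_apply_of_im_pos hz0]; exact hz hz0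

open PowerSeries in
/-- A Pick function that extends analytically to the real point `x` and whose first `N` Taylor
coefficients there are those of `α`. -/
def IsRegularSolution (x : ℝ) (N : ℕ) (α : ℂ⟦X⟧) (f : ℍ → ℂ) : Prop :=
  IsPick f ∧ ∃ F : ℂ → ℂ, AnalyticAt ℂ F x ∧
    (∀ᶠ z in 𝓝 (x : ℂ), ∀ hz : 0 < z.im, F z = f ⟨z, hz⟩) ∧
    ∀ k < N, coeff k (taylor F x) = coeff k α

variable {x : ℝ} {f : ℍ → ℂ} {F : ℂ → ℂ}

theorem sub_ofReal_ne_zero {z : ℂ} (hz : 0 < z.im) (x : ℝ) : z - x ≠ 0 := by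
  intro h
  have := congrArg Complex.im h
  simp at this
  linarith

theorem IsPick.ne_of_deriv_ne_zero (hf : IsPick f) (hF : AnalyticAt ℂ F x)
    (hfF : ∀ᶠ z in 𝓝 (x : ℂ), ∀ hz : 0 < z.im, F z = f ⟨z, hz⟩) (h0 : (F x).im = 0)
    (h1 : deriv F x ≠ 0) (z : ℍ) : f z ≠ F x := by
  intro hz
  apply h1
  have hconst : ∀ᶠ w in 𝓝 (x : ℂ), 0 < w.im → F w = F x := by
    filter_upwards [hfF] with w hw hw0
    have := eq_const_of_im_eq_zero hf.differentiableOn (fun w _ => hf.im_nonneg _) z.im_pos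
      (by simpa [hz] using h0) hw0
    rw [UpperHalfPlane.ofComplex_apply, UpperHalfPlane.ofComplex_apply_of_im_pos hw0, hz] at this
    rw [hw hw0, this]
  rw [(eventually_eq_of_eventually_upper hF analyticAt_const hconst).deriv_eq]
  simp

/-- The Julia reduction of a Pick function is a Pick function. -/
theorem IsPick.julia (hf : IsPick f) (hF : AnalyticAt ℂ F x)
    (hfF : ∀ᶠ z in 𝓝 (x : ℂ), ∀ hz : 0 < z.im, F z = f ⟨z, hz⟩) (h0 : (F x).im = 0)
    (h1 : deriv F x ≠ 0) :
    IsPick (fun z => -(f z - F x)⁻¹ + (deriv F x * (z - x))⁻¹) := by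
  have him : ∀ z : ℂ, 0 < z.im → 0 ≤ (f (UpperHalfPlane.ofComplex z)).im :=
    fun z _ => hf.im_nonneg _
  have hne := hf.ne_of_deriv_ne_zero hF hfF h0 h1
  have hpos := lt_of_le_of_ne (deriv_nonneg_of_pick him hF (eventually_ofComplex hfF) h0) h1.symm
  obtain ⟨hre, him1⟩ := Complex.lt_def.1 hpos
  simp only [zero_re, zero_im] at hre him1
  have hp := IsPick.of_differentiableOn (φ := fun z => -(f (UpperHalfPlane.ofComplex z) - F x)⁻¹ +
    (deriv F x * (z - x))⁻¹) ?_ ?_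
  · simpa using hp
  · refine DifferentiableOn.add (((hf.differentiableOn.sub_const _).inv fun z _ =>
      sub_ne_zero.2 (hne _)).neg) ?_
    refine DifferentiableOn.inv (by fun_prop) fun z hz => mul_ne_zero h1 (sub_ofReal_ne_zero hz x)
  · intro z hz
    have hJ := julia_inequality hf.differentiableOn him hF (eventually_ofComplex hfF) h0 hz
    set w := f (UpperHalfPlane.ofComplex z) with hw
    have hwne : 0 < normSq (w - F x) := normSq_pos.2 (sub_ne_zero.2 (hne _))
    have hzne : 0 < normSq (z - x) := normSq_pos.2 (sub_ofReal_ne_zero hz x)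
    have e1 : (-(w - F x)⁻¹).im = w.im / normSq (w - F x) := by
      simp only [neg_im, inv_im, sub_im, h0]
      ring
    have e2 : ((deriv F x * (z - x))⁻¹).im = -(z.im / ((deriv F x).re * normSq (z - x))) := by
      have : normSq (deriv F x) = (deriv F x).re * (deriv F x).re := by
        rw [normSq_apply, ← him1]; ring
      rw [inv_im, normSq_mul, this]
      simp only [mul_im, sub_im, sub_re, ofReal_im, ofReal_re, ← him1]
      field_simp
      ring
    -- Once denominators are cleared, nonnegativity of the imaginary part is Julia's inequality.
    rw [add_im, e1, e2, ← sub_eq_add_neg, sub_nonneg, div_le_div_iff₀ (by positivity) hwne]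
    linarith

/-- No boundary behaviour of `g` is needed: `1/(b(z - x))` has strictly negative imaginary part and
subtracting `g` only lowers it, so the inverse exists and lies in the upper half plane. -/
theorem isPick_sub_inv {g : ℍ → ℂ} (hg : IsPick g) {a b : ℂ} (ha : a.im = 0) (hb : 0 < b) :
    IsPick (fun z => a + ((b * (z - x))⁻¹ - g z)⁻¹) := by
  obtain ⟨hre, him1⟩ := Complex.lt_def.1 hb
  simp only [zero_re, zero_im] at hre him1
  have hkey : ∀ z : ℂ, 0 < z.im →
      ((b * (z - x))⁻¹ - g (UpperHalfPlane.ofComplex z)).im < 0 := by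
    intro z hz
    have hzne : 0 < normSq (z - x) := normSq_pos.2 (sub_ofReal_ne_zero hz x)
    have e2 : ((b * (z - x))⁻¹).im = -(z.im / (b.re * normSq (z - x))) := by
      have : normSq b = b.re * b.re := by rw [normSq_apply, ← him1]; ring
      rw [inv_im, normSq_mul, this]
      simp only [mul_im, sub_im, sub_re, ofReal_im, ofReal_re, ← him1]
      field_simp
      ring
    rw [sub_im, e2]
    have := hg.im_nonneg (UpperHalfPlane.ofComplex z)
    have : 0 < z.im / (b.re * normSq (z - x)) := by positivity
    linarith
  have hne : ∀ z : ℂ, 0 < z.im → ((b * (z - x))⁻¹ - g (UpperHalfPlane.ofComplex z)) ≠ 0 := by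
    intro z hz h
    have := hkey z hz
    rw [h] at this
    simp at this
  have hp := IsPick.of_differentiableOn (φ := fun z => a + ((b * (z - x))⁻¹ -
    g (UpperHalfPlane.ofComplex z))⁻¹) ?_ ?_
  · simpa using hp
  · refine DifferentiableOn.const_add _ (DifferentiableOn.inv (DifferentiableOn.sub ?_
      hg.differentiableOn) hne)
    refine DifferentiableOn.inv (by fun_prop) fun z hz =>
      mul_ne_zero hb.ne' (sub_ofReal_ne_zero hz x)
  · intro z hz
    rw [add_im, ha, zero_add, inv_im]
    exact div_nonneg (by linarith [hkey z hz]) (normSq_nonneg _)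

-- Writing `f - F x = (z - x) A` with `A = dslope F x`, the two poles of the reduced function cancel
-- and leave `-dslope (1/A)`.
open PowerSeries in
theorem exists_analytic_julia (hF : AnalyticAt ℂ F x)
    (hfF : ∀ᶠ z in 𝓝 (x : ℂ), ∀ hz : 0 < z.im, F z = f ⟨z, hz⟩) (h1 : deriv F x ≠ 0) :
    ∃ G : ℂ → ℂ, AnalyticAt ℂ G x ∧
      (∀ᶠ z in 𝓝 (x : ℂ), ∀ hz : 0 < z.im,
        G z = -(f ⟨z, hz⟩ - F x)⁻¹ + (deriv F x * (z - x))⁻¹) ∧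
      IsJuliaPair (taylor F x) (taylor G x) := by
  set A := dslope F x with hA
  have hAx : A x = deriv F x := dslope_same F _
  have hAa : AnalyticAt ℂ A x := hF.dslope_self
  have hI : AnalyticAt ℂ (fun z => (A z)⁻¹) x := hAa.fun_inv (by rw [hAx]; exact h1)
  refine ⟨fun z => -dslope (fun z => (A z)⁻¹) x z, hI.dslope_self.fun_neg, ?_, ?_⟩
  · filter_upwards [hfF] with z hz hz0
    have ht := sub_ofReal_ne_zero hz0 x
    have hzx : z ≠ x := sub_ne_zero.1 ht
    rw [dslope_of_ne _ hzx, slope_def_field, hAx, hA, dslope_of_ne _ hzx, slope_def_field, ← hz hz0]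
    rw [inv_div, mul_inv, sub_div, div_div_cancel_left' ht]
    field_simp
    ring
  · refine isJuliaPair_of_inv (W := taylor (fun z => (A z)⁻¹) x) ?_ ?_
    · rw [← taylor_dslope hF, ← taylor_mul hAa hI]
      have : (fun z => A z * (A z)⁻¹) =ᶠ[𝓝 (x : ℂ)] fun _ => 1 := by
        filter_upwards [hAa.continuousAt.eventually_ne (by rw [hAx]; exact h1)] with z hz
        exact mul_inv_cancel₀ hz
      rw [taylor_congr this, taylor_const, map_one]
    · rw [taylor_neg, taylor_dslope hI]

-- The augmented function is `a + b(z - x) / (1 - b(z - x)G)`, whose denominator is `1` at `x`.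
open PowerSeries in
theorem exists_analytic_augmentation {g : ℍ → ℂ} {G : ℂ → ℂ} (hG : AnalyticAt ℂ G x)
    (hgG : ∀ᶠ z in 𝓝 (x : ℂ), ∀ hz : 0 < z.im, G z = g ⟨z, hz⟩) (a : ℂ) {b : ℂ} (hb : b ≠ 0) :
    ∃ F : ℂ → ℂ, AnalyticAt ℂ F x ∧
      (∀ᶠ z in 𝓝 (x : ℂ), ∀ hz : 0 < z.im,
        F z = a + ((b * (z - x))⁻¹ - g ⟨z, hz⟩)⁻¹) ∧
      coeff 0 (taylor F x) = a ∧ coeff 1 (taylor F x) = b ∧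
      IsJuliaPair (taylor F x) (taylor G x) := by
  set E : ℂ → ℂ := fun z => (1 - b * ((z - x) * G z))⁻¹ with hE
  have ht : AnalyticAt ℂ (fun z : ℂ => z - x) x := by fun_prop
  have hD : AnalyticAt ℂ (fun z => 1 - b * ((z - x) * G z)) x := by fun_prop
  have hEa : AnalyticAt ℂ E x := hD.fun_inv (by simp)
  have hFa : AnalyticAt ℂ (fun z => a + (z - x) * (b * E z)) x := by fun_prop
  have hT : taylor (fun z => a + (z - x) * (b * E z)) x = C a + X * (C b * taylor E x) := by
    rw [taylor_add analyticAt_const (ht.fun_mul (analyticAt_const.fun_mul hEa)), taylor_const,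
      taylor_mul ht (analyticAt_const.fun_mul hEa), taylor_sub_self,
      taylor_mul analyticAt_const hEa, taylor_const]
  have h1 : coeff 1 (taylor (fun z => a + (z - x) * (b * E z)) x) = b := by
    have h2 : constantCoeff (taylor E x) = 1 := by
      rw [← coeff_zero_eq_constantCoeff_apply, coeff_zero_taylor]
      simp [hE]
    rw [hT, map_add, show (1 : ℕ) = 0 + 1 from rfl, coeff_succ_X_mul]
    simp [h2]
  refine ⟨fun z => a + (z - x) * (b * E z), hFa, ?_, ?_, h1, ?_⟩
  · filter_upwards [hgG] with z hz hz0
    have ht := sub_ofReal_ne_zero hz0 x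
    rw [← hz hz0, hE]
    have : (b * (z - x))⁻¹ - G z = (1 - b * ((z - x) * G z)) / (b * (z - x)) := by
      field_simp
    rw [this, inv_div, div_eq_mul_inv]
    ring
  · rw [coeff_zero_taylor]; simp
  · rw [IsJuliaPair, h1, hT, divX_C_add_X_mul]
    have hmul : taylor E x * (1 - C b * (X * taylor G x)) = 1 := by
      have h2 : taylor (fun z => 1 - b * ((z - x) * G z)) x = 1 - C b * (X * taylor G x) := by
        rw [taylor_sub analyticAt_const (analyticAt_const.fun_mul (ht.fun_mul hG)),
          taylor_mul analyticAt_const (ht.fun_mul hG), taylor_mul ht hG, taylor_const, taylor_const,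
          taylor_sub_self, map_one]
      rw [← h2, ← taylor_mul hEa hD]
      have : (fun z => E z * (1 - b * ((z - x) * G z))) =ᶠ[𝓝 (x : ℂ)] fun _ => 1 := by
        filter_upwards [hD.continuousAt.eventually_ne (show _ ≠ (0 : ℂ) by simp)] with z hz
        exact inv_mul_cancel₀ hz
      rw [taylor_congr this, taylor_const, map_one]
    rw [mul_assoc, hmul, mul_one]

/-- Julia reduction at `x`, as a bijection whose inverse is the augmentation. -/
noncomputable def juliaEquiv (x : ℝ) (a b : ℂ) : (ℍ → ℂ) ≃ (ℍ → ℂ) where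
  toFun f z := -(f z - a)⁻¹ + (b * (z - x))⁻¹
  invFun g z := a + ((b * (z - x))⁻¹ - g z)⁻¹
  left_inv f := by ext z; simp
  right_inv g := by ext z; simp

-- The inductive step of all later arguments. It includes `N = 0`, where the right-hand side still
-- asks for a Pick function analytic at `x`.
open PowerSeries in
theorem isRegularSolution_julia_iff {N : ℕ} {α : ℂ⟦X⟧} (h0 : (coeff 0 α).im = 0)
    (h1 : 0 < coeff 1 α) :
    IsRegularSolution x (N + 2) α f ↔
      IsRegularSolution x N (juliaSeries α) (juliaEquiv x (coeff 0 α) (coeff 1 α) f) := by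
  have hα := isJuliaPair_juliaSeries h1.ne'
  constructor
  · rintro ⟨hf, F, hF, hfF, hc⟩
    have hc0 : F x = coeff 0 α := by rw [← hc 0 (by omega), coeff_zero_taylor]
    have hc1 : deriv F x = coeff 1 α := by rw [← hc 1 (by omega), coeff_one_taylor]
    have hne : deriv F x ≠ 0 := by rw [hc1]; exact h1.ne'
    obtain ⟨G, hG, hgG, hpair⟩ := exists_analytic_julia hF hfF hne
    have hp := hf.julia hF hfF (by rwa [hc0]) hne
    rw [hc0, hc1] at hp hgG
    refine ⟨hp, G, hG, hgG, ?_⟩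
    exact (hpair.coeff_eq_iff hα (hc 1 (by omega)) h1.ne' (hc 0 (by omega)) N).1 hc
  · rintro ⟨hg, G, hG, hgG, hc⟩
    rw [← (juliaEquiv x (coeff 0 α) (coeff 1 α)).symm_apply_apply f]
    set g := juliaEquiv x (coeff 0 α) (coeff 1 α) f
    obtain ⟨F, hF, hfF, hF0, hF1, hpair⟩ :=
      exists_analytic_augmentation hG hgG (coeff 0 α) h1.ne'
    exact ⟨isPick_sub_inv hg h0 h1, F, hF, hfF,
      (hpair.coeff_eq_iff hα hF1 h1.ne' hF0 N).2 hc⟩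

end RegularSolution

/-! ### A convolution identity for Hankel entries. -/

section Convolution

/-- Induction moves one unit from `i` to `j`: the right-hand sides at `(i + 1, j)` and at `(i, j +
1)` both equal the sum of `A (i - k) * B (k + l) * A (j - l)` over `k ≤ i`, `l ≤ j`. The recursion
for `A` absorbs the boundary terms. -/
theorem hankel_convolution {A B : ℕ → ℂ} {b : ℂ} (hb : b ≠ 0) (h0 : A 0 = b)
    (hA : ∀ n, A (n + 1) = b * ∑ k ∈ Finset.range (n + 1), A (n - k) * B k) (i j : ℕ) :
    A (i + j) = A i * b⁻¹ * A j + ∑ k ∈ Finset.range i, ∑ l ∈ Finset.range j,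
      A (i - (k + 1)) * B (k + l + 1) * A (j - (l + 1)) := by
  induction i generalizing j with
  | zero => simp [h0, hb]
  | succ i ih =>
    have e1 : A (i + 1) * b⁻¹ * A j + ∑ k ∈ Finset.range (i + 1), ∑ l ∈ Finset.range j,
        A (i + 1 - (k + 1)) * B (k + l + 1) * A (j - (l + 1)) =
        ∑ k ∈ Finset.range (i + 1), ∑ l ∈ Finset.range (j + 1),
          A (i - k) * B (k + l) * A (j - l) := by
      simp only [Finset.sum_range_succ' _ j, Finset.sum_add_distrib, Nat.add_sub_add_right]
      rw [hA, add_comm, mul_comm b, mul_assoc, mul_assoc, mul_inv_cancel_left₀ hb, Finset.sum_mul]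
      simp [add_assoc]
    have e2 : A i * b⁻¹ * A (j + 1) + ∑ k ∈ Finset.range i, ∑ l ∈ Finset.range (j + 1),
        A (i - (k + 1)) * B (k + l + 1) * A (j + 1 - (l + 1)) =
        ∑ k ∈ Finset.range (i + 1), ∑ l ∈ Finset.range (j + 1),
          A (i - k) * B (k + l) * A (j - l) := by
      simp only [Finset.sum_range_succ' _ i, Nat.add_sub_add_right]
      rw [hA, add_comm, mul_assoc, inv_mul_cancel_left₀ hb, Finset.mul_sum]
      congr 1
      · refine Finset.sum_congr rfl fun k _ => Finset.sum_congr rfl fun l _ => ?_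
        rw [show k + 1 + l = k + l + 1 by omega]
      · refine Finset.sum_congr rfl fun l _ => ?_
        simp
        ring
    rw [e1, ← e2, ← ih (j + 1)]
    congr 1
    omega

theorem sum_range_eq_sum_fin {i m : ℕ} (h : i ≤ m) (f : ℕ → ℂ) :
    ∑ k ∈ Finset.range i, f k = ∑ k : Fin m, if (k : ℕ) < i then f k else 0 := by
  rw [Fin.sum_univ_eq_sum_range (fun k => if k < i then f k else 0), ← Finset.sum_filter]
  congr 1
  ext k
  simp
  omega

end Convolution

/-! ### Block sums with a scalar, and positivity. -/

section Border

open Matrix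

/-- The block diagonal matrix with blocks `c` and `M`. -/
def borderDiag {m : ℕ} (c : ℂ) (M : Matrix (Fin m) (Fin m) ℂ) :
    Matrix (Fin (m + 1)) (Fin (m + 1)) ℂ :=
  Matrix.of (Fin.cons (Fin.cons c 0) fun k => Fin.cons 0 (M k))

variable {m : ℕ} {c : ℂ} {M : Matrix (Fin m) (Fin m) ℂ}

@[simp] theorem borderDiag_zero_zero : borderDiag c M 0 0 = c := rfl
@[simp] theorem borderDiag_zero_succ (j : Fin m) : borderDiag c M 0 j.succ = 0 := rfl
@[simp] theorem borderDiag_succ_zero (i : Fin m) : borderDiag c M i.succ 0 = 0 := rfl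
@[simp] theorem borderDiag_succ_succ (i j : Fin m) : borderDiag c M i.succ j.succ = M i j := rfl

theorem dotProduct_borderDiag_mulVec (x : Fin (m + 1) → ℂ) :
    star x ⬝ᵥ (borderDiag c M *ᵥ x) = star (x 0) * (c * x 0) +
      star (Fin.tail x) ⬝ᵥ (M *ᵥ Fin.tail x) := by
  simp [dotProduct, mulVec, Fin.sum_univ_succ, Fin.tail]

theorem isHermitian_borderDiag (hc : 0 ≤ c) (hM : M.IsHermitian) :
    (borderDiag c M).IsHermitian := by
  refine Matrix.IsHermitian.ext fun i j => ?_
  refine Fin.cases ?_ (fun i => ?_) i <;> refine Fin.cases ?_ (fun j => ?_) j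
  · simpa using (IsSelfAdjoint.of_nonneg hc).star_eq
  · simp
  · simp
  · simpa using hM.apply i j

theorem posSemidef_borderDiag_iff (hc : 0 ≤ c) :
    (borderDiag c M).PosSemidef ↔ M.PosSemidef := by
  refine ⟨fun h => h.submatrix Fin.succ, fun h => ?_⟩
  refine PosSemidef.of_dotProduct_mulVec_nonneg (isHermitian_borderDiag hc h.isHermitian) fun x => ?_
  rw [dotProduct_borderDiag_mulVec]
  refine add_nonneg ?_ (h.dotProduct_mulVec_nonneg _)
  have : star (x 0) * (c * x 0) = c * (star (x 0) * x 0) := by ring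
  rw [this]
  exact mul_nonneg hc (star_mul_self_nonneg _)

theorem posDef_borderDiag_iff (hc : 0 < c) : (borderDiag c M).PosDef ↔ M.PosDef := by
  refine ⟨fun h => h.submatrix (Fin.succ_injective m), fun h => ?_⟩
  refine PosDef.of_dotProduct_mulVec_pos (isHermitian_borderDiag hc.le h.isHermitian) fun x hx => ?_
  rw [dotProduct_borderDiag_mulVec]
  have e : star (x 0) * (c * x 0) = c * (star (x 0) * x 0) := by ring
  rw [e]
  have h0 : 0 ≤ c * (star (x 0) * x 0) := mul_nonneg hc.le (star_mul_self_nonneg _)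
  by_cases ht : Fin.tail x = 0
  · have hx0 : x 0 ≠ 0 := by
      intro hx0
      apply hx
      ext i
      refine Fin.cases hx0 (fun i => ?_) i
      exact congrFun ht i
    rw [ht]
    simp only [star_zero, mulVec_zero, dotProduct_zero, add_zero]
    refine mul_pos hc (lt_of_le_of_ne (star_mul_self_nonneg _) (Ne.symm ?_))
    exact mul_ne_zero (star_ne_zero.2 hx0) hx0
  · exact add_pos_of_nonneg_of_pos h0 (h.dotProduct_mulVec_pos ht)

/-- The diagonal matrix whose last entry is `ε` and whose other entries vanish. -/
noncomputable def lastDiag (m : ℕ) (ε : ℝ) : Matrix (Fin m) (Fin m) ℂ :=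
  Matrix.diagonal fun i : Fin m => if (i : ℕ) + 1 = m then (ε : ℂ) else 0

/-- For `m = 0` the last diagonal entry would be the corner `c` itself. -/
theorem borderDiag_sub_lastDiag (hm : m ≠ 0) (ε : ℝ) :
    borderDiag c M - lastDiag (m + 1) ε = borderDiag c (M - lastDiag m ε) := by
  ext i j
  refine Fin.cases ?_ (fun i => ?_) i <;> refine Fin.cases ?_ (fun j => ?_) j
  · simp [lastDiag, hm.symm]
  · simp [lastDiag, (Fin.succ_ne_zero j).symm]
  · simp [lastDiag, Fin.succ_ne_zero i]
  · simp [lastDiag, Matrix.diagonal_apply]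

end Border

/-! ### Effect of the Julia reduction on Hankel matrices. -/

section Hankel

open Matrix PowerSeries

/-- The Hankel matrix of a power series. -/
noncomputable def hankelSeries (m : ℕ) (α : ℂ⟦X⟧) : Matrix (Fin m) (Fin m) ℂ :=
  Matrix.of fun i j => coeff ((i : ℕ) + j + 1) α

/-- The lower triangular Toeplitz matrix of `(α - α 0) / X`. -/
noncomputable def toeplitzSeries (m : ℕ) (α : ℂ⟦X⟧) : Matrix (Fin m) (Fin m) ℂ :=
  Matrix.of fun i k => if k ≤ i then coeff ((i : ℕ) - k + 1) α else 0

variable {α β : ℂ⟦X⟧} {m : ℕ}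

theorem IsJuliaPair.coeff_add_two (h : IsJuliaPair α β) (n : ℕ) :
    coeff (n + 2) α =
      coeff 1 α * ∑ k ∈ Finset.range (n + 1), coeff (n - k + 1) α * coeff k β := by
  rw [IsJuliaPair] at h
  have h1 : α.divX = C (coeff 1 α) + C (coeff 1 α) * (X * (β * α.divX)) := by
    linear_combination h
  have h2 := congrArg (coeff (n + 1)) h1
  rw [map_add, coeff_C_mul, coeff_succ_X_mul, coeff_divX, coeff_C, if_neg (by omega), zero_add,
    coeff_mul, Finset.Nat.sum_antidiagonal_eq_sum_range_succ
      (fun i j => coeff i β * coeff j α.divX)] at h2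
  rw [h2]
  congr 1
  refine Finset.sum_congr rfl fun k _ => ?_
  rw [coeff_divX, mul_comm]

theorem IsJuliaPair.coeff_add_add_one (h : IsJuliaPair α β) (h1 : coeff 1 α ≠ 0) (i j : ℕ) :
    coeff (i + j + 1) α = coeff (i + 1) α * (coeff 1 α)⁻¹ * coeff (j + 1) α +
      ∑ k ∈ Finset.range i, ∑ l ∈ Finset.range j,
        coeff (i - (k + 1) + 1) α * coeff (k + l + 1) β * coeff (j - (l + 1) + 1) α :=
  hankel_convolution (A := fun n => coeff (n + 1) α) (B := fun n => coeff n β) h1 rfl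
    h.coeff_add_two i j

/-- The convolution identity as a matrix product: column `0` of the Toeplitz factor carries the
weight `1/α₁`, the other columns carry the Hankel matrix of `β`. For real data this is a congruence,
so positivity transfers. -/
theorem IsJuliaPair.hankelSeries_eq (h : IsJuliaPair α β) (h1 : coeff 1 α ≠ 0) :
    hankelSeries (m + 1) α = toeplitzSeries (m + 1) α *
      borderDiag (coeff 1 α)⁻¹ (hankelSeries m β) * (toeplitzSeries (m + 1) α)ᵀ := by
  ext i j
  rw [hankelSeries, Matrix.of_apply, h.coeff_add_add_one h1,
    sum_range_eq_sum_fin (Nat.lt_succ_iff.1 i.2)]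
  simp only [sum_range_eq_sum_fin (Nat.lt_succ_iff.1 j.2)]
  simp only [Matrix.mul_apply, Fin.sum_univ_succ, Matrix.transpose_apply, borderDiag_zero_zero,
    borderDiag_zero_succ, borderDiag_succ_zero, borderDiag_succ_succ, toeplitzSeries,
    Matrix.of_apply, Nat.zero_le, if_true, Fin.val_zero, Nat.sub_zero, mul_zero, add_zero,
    Finset.sum_const_zero, zero_add, Fin.le_def, Fin.val_succ, hankelSeries]
  congr 1
  simp only [Finset.sum_mul]
  rw [Finset.sum_comm]
  refine Finset.sum_congr rfl fun k _ => ?_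
  by_cases hk : (k : ℕ) < i
  · simp [hk]
  · simp [hk]

theorem isUnit_toeplitzSeries (h1 : coeff 1 α ≠ 0) : IsUnit (toeplitzSeries m α) := by
  rw [Matrix.isUnit_iff_isUnit_det, Matrix.det_of_isLowerTriangular]
  · simp [toeplitzSeries, h1, Finset.prod_const, isUnit_iff_ne_zero]
  · intro i j hij
    have : ¬ j ≤ i := not_le.2 hij
    simp [toeplitzSeries, this]

theorem toeplitzSeries_conjTranspose (hα : ∀ k, 1 ≤ k → k ≤ m → (coeff k α).im = 0) :
    (toeplitzSeries m α)ᵀ = star (toeplitzSeries m α) := by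
  ext i j
  simp only [Matrix.transpose_apply, Matrix.star_apply, toeplitzSeries, Matrix.of_apply]
  split_ifs with h
  · exact (Complex.conj_eq_iff_im.2 (hα _ (by omega) (by have := j.2; omega))).symm
  · simp

theorem IsJuliaPair.posDef_hankelSeries_iff (h : IsJuliaPair α β) (h1 : 0 < coeff 1 α)
    (hα : ∀ k, 1 ≤ k → k ≤ m + 1 → (coeff k α).im = 0) :
    (hankelSeries (m + 1) α).PosDef ↔ (hankelSeries m β).PosDef := by
  rw [h.hankelSeries_eq h1.ne', toeplitzSeries_conjTranspose hα,
    Matrix.IsUnit.posDef_star_right_conjugate_iff (isUnit_toeplitzSeries h1.ne'),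
    posDef_borderDiag_iff (inv_pos.2 h1)]

theorem IsJuliaPair.posSemidef_hankelSeries_iff (h : IsJuliaPair α β) (h1 : 0 < coeff 1 α)
    (hα : ∀ k, 1 ≤ k → k ≤ m + 1 → (coeff k α).im = 0) :
    (hankelSeries (m + 1) α).PosSemidef ↔ (hankelSeries m β).PosSemidef := by
  rw [h.hankelSeries_eq h1.ne', toeplitzSeries_conjTranspose hα,
    Matrix.IsUnit.posSemidef_star_right_conjugate_iff (isUnit_toeplitzSeries h1.ne'),
    posSemidef_borderDiag_iff (inv_nonneg.2 h1.le)]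

/-- The last column of a lower triangular matrix has only its corner entry, here `b`. So the
congruence keeps the south-east perturbation in place, scaled by `b ^ 2`, and SE-minimality
transfers too. -/
theorem toeplitzSeries_mul_lastDiag {b : ℝ} (hb : coeff 1 α = b) (ε : ℝ) :
    toeplitzSeries (m + 1) α * lastDiag (m + 1) ε * (toeplitzSeries (m + 1) α)ᵀ =
      lastDiag (m + 1) (b ^ 2 * ε) := by
  ext i j
  have hlt : ∀ i : Fin (m + 1), ¬ i = Fin.last m → ¬ Fin.last m ≤ i := fun i hi h =>
    hi (le_antisymm (Fin.le_last i) h)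
  have hlast : ∀ i : Fin (m + 1), (i : ℕ) + 1 = m + 1 ↔ i = Fin.last m := fun i => by
    rw [Fin.ext_iff, Fin.val_last]; omega
  rw [Matrix.mul_apply, Finset.sum_eq_single (Fin.last m)]
  · rw [lastDiag, lastDiag, Matrix.mul_diagonal, Matrix.transpose_apply, Matrix.diagonal_apply]
    simp only [hlast, if_true, toeplitzSeries, Matrix.of_apply]
    by_cases hi : i = Fin.last m <;> by_cases hj : j = Fin.last m
    · subst hi; subst hj
      simp [hb]
      ring
    · simp [hlt j hj, hi, Ne.symm hj]
    · simp [hlt i hi, hi]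
    · simp [hlt i hi, hi]
  · intro k _ hk
    rw [lastDiag, Matrix.mul_diagonal, if_neg (by rwa [hlast])]
    simp
  · simp

theorem IsJuliaPair.isSEMinimallyPositive_hankelSeries_iff (h : IsJuliaPair α β)
    (h1 : 0 < coeff 1 α) (hm : m ≠ 0)
    (hα : ∀ k, 1 ≤ k → k ≤ m + 1 → (coeff k α).im = 0) :
    IsSEMinimallyPositive (hankelSeries (m + 1) α) ↔ IsSEMinimallyPositive (hankelSeries m β) := by
  obtain ⟨b, hb⟩ : ∃ b : ℝ, coeff 1 α = b :=
    ⟨(coeff 1 α).re, Complex.ext (by simp) (by simpa using hα 1 le_rfl (by omega))⟩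
  have hb0 : 0 < b := by rw [hb] at h1; exact_mod_cast h1
  have key : ∀ ε : ℝ, (hankelSeries (m + 1) α - lastDiag (m + 1) (b ^ 2 * ε)).PosSemidef ↔
      (hankelSeries m β - lastDiag m ε).PosSemidef := by
    intro ε
    rw [h.hankelSeries_eq h1.ne', ← toeplitzSeries_mul_lastDiag hb, ← sub_mul, ← mul_sub,
      toeplitzSeries_conjTranspose hα, borderDiag_sub_lastDiag hm,
      Matrix.IsUnit.posSemidef_star_right_conjugate_iff (isUnit_toeplitzSeries h1.ne'),
      posSemidef_borderDiag_iff (inv_nonneg.2 h1.le)]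
  refine and_congr (h.posSemidef_hankelSeries_iff h1 hα) ⟨fun H ε hε => ?_, fun H ε hε => ?_⟩
  · exact (not_congr (key ε)).1 (H _ (by positivity))
  · have := (not_congr (key (ε / b ^ 2))).2 (H _ (by positivity))
    rwa [mul_div_cancel₀ _ (by positivity)] at this

/-- Subtracting the whole entry leaves the zero matrix. -/
theorem not_isSEMinimallyPositive_hankelSeries_one (h1 : 0 < coeff 1 α) :
    ¬ IsSEMinimallyPositive (hankelSeries 1 α) := by
  rintro ⟨-, H⟩
  obtain ⟨hre, him⟩ := Complex.lt_def.1 h1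
  refine H (coeff 1 α).re hre ?_
  convert Matrix.PosSemidef.zero (R := ℂ) (n := Fin 1) using 1
  ext i j
  fin_cases i; fin_cases j
  apply Complex.ext <;> simp [hankelSeries, ← him]

/-- In the recursion for the coefficient `n + 2` of `α`, every factor is real except the coefficient
`n` of `β`, which appears with the factor `b ^ 2`. -/
theorem IsJuliaPair.im_coeff (h : IsJuliaPair α β) {b : ℝ} (hb : coeff 1 α = b) (hb0 : b ≠ 0)
    (n : ℕ) (hα : ∀ k, 1 ≤ k → k < n + 2 → (coeff k α).im = 0) :
    (coeff (n + 2) α).im = b ^ 2 * (coeff n β).im := by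
  induction n using Nat.strong_induction_on with
  | _ n ih =>
    have hβ : ∀ k < n, (coeff k β).im = 0 := by
      intro k hk
      have := ih k hk fun j hj1 hj => hα j hj1 (by omega)
      rw [hα (k + 2) (by omega) (by omega)] at this
      have hb2 : b ^ 2 ≠ 0 := by positivity
      simpa [hb2] using this.symm
    rw [h.coeff_add_two, hb, Complex.im_ofReal_mul, Complex.im_sum, Finset.sum_range_succ,
      Finset.sum_eq_zero]
    · simp [hb]
      ring
    · intro k hk
      have hk := Finset.mem_range.1 hk
      rw [Complex.mul_im, hβ k hk, hα _ (by omega) (by omega)]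
      simp

/-- The coefficients of index at least one form a Hankel matrix of finite rank `q` that has a
triangular factorization. -/
def HasHankelFactorization (α : ℂ⟦X⟧) (q : ℕ) : Prop :=
  ∃ (Z : ℕ → Fin q → ℂ) (d : Fin q → ℂ), (∀ l, d l ≠ 0) ∧ (∀ (i : ℕ) (l : Fin q), i < l → Z i l = 0) ∧
    (∀ l : Fin q, Z l l ≠ 0) ∧ ∀ i j, coeff (i + j + 1) α = ∑ l, Z i l * d l * Z j l

/-- The old columns are convolved with `α`, which pushes them down one row, and the column of
coefficients of `α` with weight `1/α₁` is placed in front. -/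
theorem IsJuliaPair.hasHankelFactorization (h : IsJuliaPair α β) (h1 : coeff 1 α ≠ 0) {q : ℕ}
    (hβ : HasHankelFactorization β q) : HasHankelFactorization α (q + 1) := by
  obtain ⟨Z, d, hd, hZ, hZd, hβ⟩ := hβ
  set Y : ℕ → Fin q → ℂ := fun i l => ∑ k ∈ Finset.range i, coeff (i - (k + 1) + 1) α * Z k l
  refine ⟨fun i => Fin.cons (coeff (i + 1) α) (Y i), Fin.cons (coeff 1 α)⁻¹ d, ?_, ?_, ?_, ?_⟩
  · exact Fin.cases (inv_ne_zero h1) hd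
  · intro i l
    refine Fin.cases (fun h => absurd h (by simp)) (fun l hl => ?_) l
    change Y i l = 0
    refine Finset.sum_eq_zero fun k hk => ?_
    have hk := Finset.mem_range.1 hk
    rw [Fin.val_succ] at hl
    rw [hZ k l (by omega), mul_zero]
  · refine Fin.cases (by simpa using h1) (fun l => ?_)
    simp only [Fin.cons_succ, Fin.val_succ, Y]
    rw [Finset.sum_range_succ, Finset.sum_eq_zero fun k hk => by
      rw [hZ k l (Finset.mem_range.1 hk), mul_zero]]
    simpa using ⟨h1, hZd l⟩
  · intro i j
    rw [h.coeff_add_add_one h1, Fin.sum_univ_succ]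
    simp only [Fin.cons_zero, Fin.cons_succ, Y]
    congr 1
    trans ∑ k ∈ Finset.range i, ∑ p, ∑ l ∈ Finset.range j,
        coeff (i - (k + 1) + 1) α * (Z k p * d p * Z l p) * coeff (j - (l + 1) + 1) α
    · refine Finset.sum_congr rfl fun k _ => ?_
      rw [Finset.sum_comm]
      refine Finset.sum_congr rfl fun l _ => ?_
      rw [hβ, Finset.mul_sum, Finset.sum_mul]
    · rw [Finset.sum_comm]
      refine Finset.sum_congr rfl fun p _ => ?_
      rw [Finset.sum_mul, Finset.sum_mul]
      refine Finset.sum_congr rfl fun k _ => ?_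
      rw [Finset.mul_sum]
      refine Finset.sum_congr rfl fun l _ => ?_
      ring

end Hankel

/-! ### Interpolation when the constant term is interior. -/

section Interpolation

open Complex PowerSeries

variable {x : ℝ} {N : ℕ} {α : ℂ⟦X⟧}

/-- The real part of `1 - I * M * t` is `1 + M * t.im ≥ 1`, and its imaginary part is `-M * t.re`.
-/
theorem norm_mul_le_norm_one_sub {M : ℝ} (hM : 0 < M) {t : ℂ} (ht : 0 ≤ t.im) :
    ‖(M : ℂ) * t‖ ≤ ‖1 - I * M * t‖ ∧ 1 ≤ ‖1 - I * M * t‖ := by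
  have h1 : normSq (1 - I * M * t) = (1 + M * t.im) ^ 2 + (M * t.re) ^ 2 := by
    simp [normSq_apply]
    ring
  have h2 : normSq ((M : ℂ) * t) = (M * t.im) ^ 2 + (M * t.re) ^ 2 := by
    simp [normSq_apply]
    ring
  have h3 : 0 ≤ M * t.im := by positivity
  constructor
  · rw [← abs_norm, ← abs_norm (1 - I * M * t), ← sq_le_sq, ← normSq_eq_norm_sq,
      ← normSq_eq_norm_sq, h1, h2]
    nlinarith
  · rw [← abs_norm, ← abs_one, ← sq_le_sq, ← normSq_eq_norm_sq, h1]
    nlinarith [sq_nonneg (M * t.re), sq_nonneg (M * t.im)]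

/-- Analytic functions on the upper half plane that are arbitrarily small, and tangent to the
identity to arbitrarily high order at a boundary point. -/
theorem exists_small_tangent_to_identity (x : ℝ) (N : ℕ) {δ : ℝ} (hδ : 0 < δ) :
    ∃ (χ : ℂ → ℂ) (V : ℂ⟦X⟧), DifferentiableOn ℂ χ {z | 0 < z.im} ∧ AnalyticAt ℂ χ x ∧
      χ x = 0 ∧ (∀ z, 0 < z.im → ‖χ z‖ < δ) ∧ taylor χ x = X - X * (X * V) ^ N := by
  obtain ⟨M, hM0, hM⟩ : ∃ M : ℝ, 0 < M ∧ N / M < δ := by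
    refine ⟨N / δ + 1, by positivity, ?_⟩
    rw [div_lt_iff₀ (by positivity), mul_add, mul_div_cancel₀ _ hδ.ne']
    linarith
  have hden : ∀ z : ℂ, 0 ≤ z.im → 1 - I * M * (z - x) ≠ 0 := by
    intro z hz h
    have := (norm_mul_le_norm_one_sub hM0 (t := z - x) (by simpa using hz)).2
    rw [h, norm_zero] at this
    linarith
  -- With `t = z - x` and `u = 1/(1 - I * M * t)` one has `t * v = 1 - u`, and the function is `χ =
  -- t - t(1 - u)^N`. It is tangent to `t` because `1 - u` vanishes at `x`. It is small because `χ =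
  -- t u ∑ (1 - u)^i` with `|t u| ≤ 1/M` and `|1 - u| ≤ 1`, so `|χ| ≤ N/M`.
  set v : ℂ → ℂ := fun z => -(I * M) * (1 - I * M * (z - x))⁻¹ with hv
  have hva : ∀ z : ℂ, 0 ≤ z.im → AnalyticAt ℂ v z := by
    intro z hz
    have : AnalyticAt ℂ (fun z : ℂ => 1 - I * M * (z - x)) z := by fun_prop
    exact analyticAt_const.fun_mul (this.fun_inv (hden z hz))
  have hχa : ∀ z : ℂ, 0 ≤ z.im →
      AnalyticAt ℂ (fun z => (z - x) - (z - x) * ((z - x) * v z) ^ N) z := by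
    intro z hz
    have := hva z hz
    fun_prop
  have hx : AnalyticAt ℂ v x := hva x (by simp)
  have ht : AnalyticAt ℂ (fun z : ℂ => z - x) x := by fun_prop
  refine ⟨fun z => (z - x) - (z - x) * ((z - x) * v z) ^ N, taylor v x,
    fun z hz => (hχa z (le_of_lt hz)).differentiableAt.differentiableWithinAt, hχa x (by simp),
    by simp, ?_, ?_⟩
  · intro z hz
    set t := z - x with ht
    have htim : 0 ≤ t.im := by simpa [ht] using hz.le
    set u := (1 - I * M * t)⁻¹ with hu
    have hd := hden z hz.le
    obtain ⟨h1, h2⟩ := norm_mul_le_norm_one_sub hM0 htim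
    have hpos : 0 < ‖1 - I * M * t‖ := by linarith
    have e1 : t * v z = 1 - u := by
      have h3 : u * (1 - I * M * t) = 1 := inv_mul_cancel₀ hd
      have h4 : v z = -(I * M) * u := rfl
      rw [h4]
      linear_combination h3
    have hw : ‖1 - u‖ ≤ 1 := by
      rw [← e1]
      have : t * v z = (-I) * (M * t / (1 - I * M * t)) := by
        have h4 : v z = -(I * M) * u := rfl
        rw [h4, hu, div_eq_mul_inv]
        ring
      rw [this, norm_mul, norm_neg, norm_I, one_mul, norm_div, div_le_one hpos]
      exact h1
    have hMt : ‖t * u‖ ≤ 1 / M := by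
      rw [hu, norm_mul, norm_inv, ← div_eq_mul_inv, div_le_div_iff₀ hpos hM0, one_mul]
      rw [norm_mul, norm_real, Real.norm_of_nonneg hM0.le] at h1
      linarith
    have e2 : t - t * (t * v z) ^ N = t * u * ∑ i ∈ Finset.range N, (1 - u) ^ i := by
      have := mul_neg_geom_sum (1 - u) N
      rw [sub_sub_cancel] at this
      rw [e1, mul_assoc, this]
      ring
    calc ‖t - t * (t * v z) ^ N‖ ≤ 1 / M * ∑ i ∈ Finset.range N, ‖(1 - u) ^ i‖ := by
          rw [e2, norm_mul]
          exact mul_le_mul hMt (norm_sum_le _ _) (norm_nonneg _) (by positivity)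
      _ ≤ 1 / M * ∑ i ∈ Finset.range N, 1 := by
          gcongr with i _
          rw [norm_pow]
          exact pow_le_one₀ (norm_nonneg _) hw
      _ = N / M := by simp; ring
      _ < δ := hM
  · rw [taylor_sub ht (ht.fun_mul ((ht.fun_mul hx).fun_pow N)),
      taylor_mul ht ((ht.fun_mul hx).fun_pow N), taylor_pow (ht.fun_mul hx), taylor_mul ht hx,
      taylor_sub_self]

/-- If the constant term has positive imaginary part, the other coefficients are arbitrary. -/
theorem exists_isRegularSolution_of_im_pos (x : ℝ) (N : ℕ) (h0 : 0 < (coeff 0 α).im) :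
    ∃ f, IsRegularSolution x (N + 1) α f := by
  set p := trunc (N + 1) α with hp
  have hp0 : p.eval 0 = coeff 0 α := by
    rw [← Polynomial.coeff_zero_eq_eval_zero, hp, coeff_trunc, if_pos (by omega)]
  have hcont : ∀ᶠ w in 𝓝 (0 : ℂ), 0 < (p.eval w).im := by
    have : ContinuousAt (fun w => (p.eval w).im) 0 :=
      (continuous_im.comp p.continuous).continuousAt
    exact this.eventually_const_lt (by simpa only [hp0] using h0)
  obtain ⟨δ, hδ, hball⟩ := Metric.eventually_nhds_iff.1 hcont
  -- `p` maps the disc of radius `δ` into the half plane and `χ` maps the half plane into that disc;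
  -- since `χ` is tangent to `z - x` beyond order `N`, `p ∘ χ` has the coefficients of `p`.
  obtain ⟨χ, V, hχd, hχa, hχ0, hχs, hχt⟩ := exists_small_tangent_to_identity x (N + 1) hδ
  refine ⟨fun z => p.eval (χ z), ?_, fun z => p.eval (χ z), ?_, ?_, ?_⟩
  · refine IsPick.of_differentiableOn (φ := fun z => p.eval (χ z)) ?_ fun z hz => ?_
    · exact p.differentiable.comp_differentiableOn hχd
    · exact (hball (by simpa using hχs z hz)).le
  · have : AnalyticAt ℂ (fun w => p.eval w) (χ x) := p.differentiable.analyticAt _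
    exact this.comp hχa
  · exact Eventually.of_forall fun z hz => rfl
  · intro k hk
    rw [taylor_polynomial_eval p hχa, hχt]
    have hdvd : X ^ (N + 1) ∣ Polynomial.aeval (X - X * (X * V) ^ (N + 1)) p - (p : ℂ⟦X⟧) := by
      have h1 := Polynomial.sub_dvd_eval_sub (X - X * (X * V) ^ (N + 1)) X (p.map C)
      rw [Polynomial.eval_map, Polynomial.eval_map, Polynomial.eval₂_C_X_eq_coe] at h1
      refine Dvd.dvd.trans ?_ h1
      exact ⟨-(X * V ^ (N + 1)), by ring⟩
    have h2 := X_pow_dvd_iff.1 hdvd k hk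
    rw [map_sub, sub_eq_zero] at h2
    rw [h2, Polynomial.coeff_coe, hp, coeff_trunc, if_pos hk]

end Interpolation

/-! ### Constraints on the first two coefficients, and transport along the reduction. -/

section Necessity

open Complex PowerSeries

variable {x : ℝ} {N : ℕ} {α : ℂ⟦X⟧} {f : ℍ → ℂ} {F : ℂ → ℂ}

theorem IsPick.deriv_nonneg (hf : IsPick f) (hF : AnalyticAt ℂ F x)
    (hfF : ∀ᶠ z in 𝓝 (x : ℂ), ∀ hz : 0 < z.im, F z = f ⟨z, hz⟩) (h0 : (F x).im = 0) :
    0 ≤ deriv F x :=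
  deriv_nonneg_of_pick (fun _ _ => hf.im_nonneg _) hF (eventually_ofComplex hfF) h0

theorem IsPick.eq_const (hf : IsPick f) (hF : AnalyticAt ℂ F x)
    (hfF : ∀ᶠ z in 𝓝 (x : ℂ), ∀ hz : 0 < z.im, F z = f ⟨z, hz⟩) (h0 : (F x).im = 0)
    (h1 : deriv F x = 0) : (f = fun _ => F x) ∧ taylor F x = C (F x) := by
  have hc : f = fun _ => F x := by
    ext z
    have := eq_const_of_deriv_eq_zero hf.differentiableOn (fun _ _ => hf.im_nonneg _) hF
      (eventually_ofComplex hfF) h0 h1 z.im_pos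
    rwa [UpperHalfPlane.ofComplex_apply] at this
  refine ⟨hc, ?_⟩
  rw [taylor_congr (eventually_eq_of_eventually_upper hF analyticAt_const
    (hfF.mono fun z hz hz0 => by rw [hz hz0, hc])), taylor_const]

theorem IsRegularSolution.im_coeff_zero_nonneg (hf : IsRegularSolution x (N + 1) α f) :
    0 ≤ (coeff 0 α).im := by
  obtain ⟨hf, F, hF, hfF, hc⟩ := hf
  rw [← hc 0 (by omega), coeff_zero_taylor]
  have h1 := (continuous_im.tendsto _).comp
    (hF.continuousAt.tendsto.comp (tendsto_add_mul_nhdsGT x I))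
  refine ge_of_tendsto h1 ?_
  filter_upwards [(tendsto_add_mul_nhdsGT x I).eventually hfF, self_mem_nhdsWithin] with s hs hs0
  have hs0' : (0 : ℝ) < s := hs0
  have : 0 < ((x : ℂ) + s * I).im := by simpa using hs0'
  simp only [Function.comp_apply]
  rw [hs this]
  exact hf.im_nonneg _

theorem IsRegularSolution.coeff_one_nonneg (hf : IsRegularSolution x (N + 2) α f)
    (h0 : (coeff 0 α).im = 0) : 0 ≤ coeff 1 α := by
  obtain ⟨hf, F, hF, hfF, hc⟩ := hf
  rw [← hc 0 (by omega), coeff_zero_taylor] at h0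
  rw [← hc 1 (by omega), coeff_one_taylor]
  exact hf.deriv_nonneg hF hfF h0

theorem IsRegularSolution.eq_const (hf : IsRegularSolution x (N + 2) α f)
    (h0 : (coeff 0 α).im = 0) (h1 : coeff 1 α = 0) :
    (f = fun _ => coeff 0 α) ∧ ∀ k, 1 ≤ k → k < N + 2 → coeff k α = 0 := by
  obtain ⟨hf, F, hF, hfF, hc⟩ := hf
  have hF0 : F x = coeff 0 α := by rw [← hc 0 (by omega), coeff_zero_taylor]
  rw [← hc 1 (by omega), coeff_one_taylor] at h1
  obtain ⟨h2, h3⟩ := hf.eq_const hF hfF (by rwa [hF0]) h1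
  refine ⟨by rw [h2, hF0], fun k hk1 hk => ?_⟩
  rw [← hc k hk, h3, coeff_C, if_neg (by omega)]

theorem isRegularSolution_const (h0 : 0 ≤ (coeff 0 α).im)
    (h : ∀ k, 1 ≤ k → k < N → coeff k α = 0) : IsRegularSolution x N α fun _ => coeff 0 α := by
  refine ⟨isPick_const h0, fun _ => coeff 0 α, analyticAt_const, by simp, fun k hk => ?_⟩
  rw [taylor_const, coeff_C]
  split_ifs with h0
  · rw [h0]
  · exact (h k (by omega) hk).symm

theorem exists_isRegularSolution_julia_iff (h0 : (coeff 0 α).im = 0) (h1 : 0 < coeff 1 α) :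
    (∃ f, IsRegularSolution x (N + 2) α f) ↔ ∃ g, IsRegularSolution x N (juliaSeries α) g :=
  (juliaEquiv x (coeff 0 α) (coeff 1 α)).exists_congr fun _ => isRegularSolution_julia_iff h0 h1

theorem existsUnique_isRegularSolution_julia_iff (h0 : (coeff 0 α).im = 0) (h1 : 0 < coeff 1 α) :
    (∃! f, IsRegularSolution x (N + 2) α f) ↔ ∃! g, IsRegularSolution x N (juliaSeries α) g :=
  (juliaEquiv x (coeff 0 α) (coeff 1 α)).existsUnique_congr fun _ =>
    isRegularSolution_julia_iff h0 h1

theorem im_coeff_juliaSeries (h1 : 0 < coeff 1 α) (n : ℕ)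
    (hα : ∀ k, 1 ≤ k → k < n + 2 → (coeff k α).im = 0) :
    ∃ c : ℝ, 0 < c ∧ (coeff (n + 2) α).im = c * (coeff n (juliaSeries α)).im := by
  have hb : coeff 1 α = (coeff 1 α).re := Complex.ext (by simp) (by simpa using
    (Complex.lt_def.1 h1).2.symm)
  have hb0 : 0 < (coeff 1 α).re := (Complex.lt_def.1 h1).1
  exact ⟨_, by positivity,
    (isJuliaPair_juliaSeries h1.ne').im_coeff hb hb0.ne' n hα⟩

theorem im_coeff_juliaSeries_eq_zero (h1 : 0 < coeff 1 α) {N : ℕ}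
    (hα : ∀ k < N + 2, (coeff k α).im = 0) : ∀ k < N, (coeff k (juliaSeries α)).im = 0 := by
  intro k hk
  obtain ⟨c, hc, h⟩ := im_coeff_juliaSeries h1 k fun j _ hj => hα j (by omega)
  rw [hα (k + 2) (by omega)] at h
  simpa [hc.ne'] using h.symm

end Necessity

/-! ### Solvability and uniqueness for the analytic problem, by induction on the reduction. -/

section Hankel

open Matrix PowerSeries

variable {x : ℝ} {N m : ℕ} {α : ℂ⟦X⟧}

theorem coeff_one_nonneg_of_posSemidef (h : (hankelSeries (m + 1) α).PosSemidef) :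
    0 ≤ coeff 1 α := h.diag_nonneg (i := 0)

theorem coeff_one_pos_of_posDef (h : (hankelSeries (m + 1) α).PosDef) : 0 < coeff 1 α :=
  h.diag_pos (i := 0)

theorem Matrix.PosSemidef.apply_eq_zero_of_diag_eq_zero {n : Type*} [Fintype n] [DecidableEq n]
    {A : Matrix n n ℂ} (hA : A.PosSemidef) {i : n} (hi : A i i = 0) (j : n) : A j i = 0 := by
  have h := (hA.dotProduct_mulVec_zero_iff (Pi.single i 1)).1 (by
    simp [hi])
  have := congrFun h j
  simpa using this

/-- A zero diagonal entry of a positive semidefinite matrix annihilates its column. By the Hankel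
structure the zeros spread from the north-west corner to every entry but the south-east one, which
SE-minimality removes. -/
theorem coeff_eq_zero_of_isSEMinimallyPositive
    (h : IsSEMinimallyPositive (hankelSeries (m + 1) α)) (h1 : coeff 1 α = 0) :
    ∀ k, 1 ≤ k → k < 2 * (m + 1) → coeff k α = 0 := by
  have key : ∀ k, k < 2 * m → coeff (k + 1) α = 0 := by
    intro k
    induction k using Nat.strong_induction_on with
    | _ k ih =>
      intro hk
      rcases Nat.eq_zero_or_pos k with rfl | hk0
      · exact h1
      -- Truncated subtraction: column `0` serves while `k ≤ m`, column `k - m` afterwards. Its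
      -- diagonal index `2(k - m)` is below `k` exactly because `k < 2m`.
      have hi : coeff ((k - m) + (k - m) + 1) α = 0 := ih _ (by omega) (by omega)
      have := h.1.apply_eq_zero_of_diag_eq_zero (i := ⟨k - m, by omega⟩) (by exact hi)
        ⟨k - (k - m), by omega⟩
      have h2 : k - (k - m) + (k - m) + 1 = k + 1 := by omega
      simpa [hankelSeries, h2] using this
  have hnn : 0 ≤ coeff (m + m + 1) α := h.1.diag_nonneg (i := Fin.last m)
  obtain ⟨hre, him⟩ := Complex.le_def.1 hnn
  have hlast : coeff (m + m + 1) α = 0 := by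
    by_contra hne
    have hpos : 0 < (coeff (m + m + 1) α).re :=
      lt_of_le_of_ne hre fun h0 => hne (Complex.ext h0.symm him.symm)
    refine h.2 _ hpos ?_
    convert Matrix.PosSemidef.zero (R := ℂ) (n := Fin (m + 1)) using 1
    ext i j
    rw [Matrix.sub_apply, Matrix.diagonal_apply, Matrix.zero_apply, sub_eq_zero, hankelSeries,
      Matrix.of_apply]
    by_cases hij : (i : ℕ) + j < 2 * m
    · rw [key _ hij]
      split_ifs with h1 h2
      · subst h1; omega
      · rfl
      · rfl
    · have hi : (i : ℕ) = m := by omega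
      have hj : (j : ℕ) = m := by omega
      rw [if_pos (Fin.ext (by omega)), if_pos (by omega), hi, hj]
      exact Complex.ext (by simp) (by simp [← him])
  intro k hk1 hk
  by_cases hk2 : k = m + m + 1
  · rw [hk2, hlast]
  · obtain ⟨j, rfl⟩ := Nat.exists_eq_add_of_le' hk1
    exact key j (by omega)

theorem isSEMinimallyPositive_of_coeff_eq_zero
    (h : ∀ k, 1 ≤ k → k < 2 * (m + 1) → coeff k α = 0) :
    IsSEMinimallyPositive (hankelSeries (m + 1) α) := by
  have h0 : hankelSeries (m + 1) α = 0 := by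
    ext i j
    exact h _ (by omega) (by omega)
  rw [h0]
  refine ⟨Matrix.PosSemidef.zero, fun ε hε hp => ?_⟩
  have := hp.diag_nonneg (i := Fin.last m)
  simp only [zero_sub, Matrix.neg_apply, Matrix.diagonal_apply_eq, Fin.val_last, if_true,
    Left.nonneg_neg_iff] at this
  exact absurd hε (not_lt.2 (by exact_mod_cast this))

/-- Each reduction lowers the index of the first non-real coefficient by two, down to `1`, where a
real boundary value forces a real derivative. A vanishing `α₁` on the way would make the solution
constant and all later coefficients zero. -/
theorem not_exists_isRegularSolution_of_odd (j : ℕ) (hN : 2 * j + 1 < N)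
    (hα : ∀ k < 2 * j + 1, (coeff k α).im = 0) (hj : (coeff (2 * j + 1) α).im ≠ 0) :
    ¬ ∃ f, IsRegularSolution x N α f := by
  induction j generalizing N α with
  | zero =>
    obtain ⟨N, rfl⟩ := Nat.exists_eq_add_of_le' (show 2 ≤ N by omega)
    rintro ⟨f, hf⟩
    exact hj (Complex.le_def.1 (hf.coeff_one_nonneg (hα 0 (by omega)))).2.symm
  | succ j ih =>
    obtain ⟨N, rfl⟩ := Nat.exists_eq_add_of_le' (show 2 ≤ N by omega)
    rintro ⟨f, hf⟩
    have h0 := hα 0 (by omega)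
    rcases (hf.coeff_one_nonneg h0).eq_or_lt with h1 | h1
    · rw [(hf.eq_const h0 h1.symm).2 _ (by omega) (by omega)] at hj
      simp at hj
    · obtain ⟨c, hc, h2⟩ := im_coeff_juliaSeries h1 (2 * j + 1) fun k _ hk => hα k (by omega)
      refine ih (by omega) (im_coeff_juliaSeries_eq_zero h1 fun k hk => hα k (by omega)) ?_
        ((exists_isRegularSolution_julia_iff h0 h1).1 ⟨f, hf⟩)
      intro h3
      rw [h3, mul_zero] at h2
      exact hj h2

theorem posDef_of_isEmpty (M : Matrix (Fin 0) (Fin 0) ℂ) : M.PosDef :=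
  PosDef.of_dotProduct_mulVec_pos (Subsingleton.elim _ _) fun _ hx =>
    absurd (Subsingleton.elim _ _) hx

/-- As in the odd case, but the descent ends at index `0`, where a positive imaginary part is both
necessary and sufficient. -/
theorem exists_isRegularSolution_iff_of_even (hN : 2 * m < N)
    (hα : ∀ k < 2 * m, (coeff k α).im = 0) (hm : (coeff (2 * m) α).im ≠ 0) :
    (∃ f, IsRegularSolution x N α f) ↔
      (hankelSeries m α).PosDef ∧ 0 < (coeff (2 * m) α).im := by
  induction m generalizing N α with
  | zero =>
    obtain ⟨N, rfl⟩ := Nat.exists_eq_add_of_le' (show 1 ≤ N by omega)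
    refine ⟨?_, fun h => exists_isRegularSolution_of_im_pos x N h.2⟩
    rintro ⟨f, hf⟩
    exact ⟨posDef_of_isEmpty _, lt_of_le_of_ne hf.im_coeff_zero_nonneg (Ne.symm hm)⟩
  | succ m ih =>
    obtain ⟨N, rfl⟩ := Nat.exists_eq_add_of_le' (show 2 ≤ N by omega)
    have h0 := hα 0 (by omega)
    have key : 0 < coeff 1 α → ((∃ f, IsRegularSolution x (N + 2) α f) ↔
        (hankelSeries (m + 1) α).PosDef ∧ 0 < (coeff (2 * (m + 1)) α).im) := by
      intro h1
      obtain ⟨c, hc, h2⟩ := im_coeff_juliaSeries h1 (2 * m) fun k _ hk => hα k (by omega)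
      rw [show 2 * m + 2 = 2 * (m + 1) by ring] at h2
      rw [exists_isRegularSolution_julia_iff h0 h1, ih (by omega)
        (im_coeff_juliaSeries_eq_zero h1 fun k hk => hα k (by omega))
        (fun h3 => hm (by rw [h2, h3, mul_zero])),
        (isJuliaPair_juliaSeries h1.ne').posDef_hankelSeries_iff h1
          (fun k _ hk => hα k (by omega)), h2, mul_pos_iff_of_pos_left hc]
    refine ⟨fun hex => ?_, fun h => (key (coeff_one_pos_of_posDef h.1)).2 h⟩
    obtain ⟨f, hf⟩ := hex
    rcases (hf.coeff_one_nonneg h0).eq_or_lt with h1 | h1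
    · rw [(hf.eq_const h0 h1.symm).2 _ (by omega) (by omega)] at hm
      simp at hm
    · exact (key h1).1 ⟨f, hf⟩

/-- After `m` reductions at most one real coefficient `c` remains, and both `c` and `c + (z - x)`
interpolate it. -/
theorem exists_ne_isRegularSolution_of_posDef (hN : N = 2 * m ∨ N = 2 * m + 1)
    (hα : ∀ k < N, (coeff k α).im = 0) (hpd : (hankelSeries m α).PosDef) :
    ∃ f g, f ≠ g ∧ IsRegularSolution x N α f ∧ IsRegularSolution x N α g := by
  induction m generalizing N α with
  | zero =>
    have hc : ∃ c : ℂ, c.im = 0 ∧ ∀ k < N, coeff k α = c := by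
      rcases hN with rfl | rfl
      · exact ⟨0, rfl, fun k hk => by omega⟩
      · exact ⟨coeff 0 α, hα 0 (by omega), fun k hk => by rw [show k = 0 by omega]⟩
    obtain ⟨c, hc, hk⟩ := hc
    refine ⟨fun _ => c, fun z => c + (z - x), ?_, ⟨isPick_const hc.ge, fun _ => c,
      analyticAt_const, by simp, ?_⟩, ⟨?_, fun z => c + (z - x), by fun_prop, by simp, ?_⟩⟩
    · intro h
      have := congrFun h UpperHalfPlane.I
      simp [sub_ofReal_ne_zero (z := Complex.I) (by simp) x] at this
    · intro k hkN
      rw [hk k hkN, show k = 0 by omega, coeff_zero_taylor]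
    · refine IsPick.of_differentiableOn (φ := fun z => c + (z - x)) (by fun_prop) fun z hz => ?_
      simpa [hc] using hz.le
    · intro k hkN
      rw [hk k hkN, show k = 0 by omega, coeff_zero_taylor]
      simp
  | succ m ih =>
    obtain ⟨N, rfl⟩ := Nat.exists_eq_add_of_le' (show 2 ≤ N by omega)
    have h0 := hα 0 (by omega)
    have h1 := coeff_one_pos_of_posDef hpd
    obtain ⟨f, g, hfg, hf, hg⟩ := ih (N := N) (α := juliaSeries α) (by omega)
      (im_coeff_juliaSeries_eq_zero h1 hα)
      (((isJuliaPair_juliaSeries h1.ne').posDef_hankelSeries_iff h1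
          (fun k _ hk => hα k (by omega))).1 hpd)
    set e := juliaEquiv x (coeff 0 α) (coeff 1 α)
    refine ⟨e.symm f, e.symm g, e.symm.injective.ne hfg, ?_, ?_⟩
    · exact (isRegularSolution_julia_iff h0 h1).2 (by simpa [e] using hf)
    · exact (isRegularSolution_julia_iff h0 h1).2 (by simpa [e] using hg)

/-- The descent must meet `α₁ = 0`, where the constant is the only solution: a positive `1 × 1`
matrix is not SE-minimal, so the data cannot run out first. -/
theorem existsUnique_isRegularSolution_of_isSEMinimallyPositive
    (hα : ∀ k < 2 * m, (coeff k α).im = 0) (hse : IsSEMinimallyPositive (hankelSeries m α)) :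
    ∃! f, IsRegularSolution x (2 * m) α f := by
  induction m generalizing α with
  -- An empty matrix has no last entry, so the perturbed matrix is still positive semidefinite.
  | zero => exact absurd (posDef_of_isEmpty _).posSemidef (hse.2 1 one_pos)
  | succ m ih =>
    have h0 := hα 0 (by omega)
    rcases (coeff_one_nonneg_of_posSemidef hse.1).eq_or_lt with h1 | h1
    · exact ⟨_, isRegularSolution_const h0.ge
        (coeff_eq_zero_of_isSEMinimallyPositive hse h1.symm), fun f hf =>
          (IsRegularSolution.eq_const (N := 2 * m) hf h0 h1.symm).1⟩
    · rcases eq_or_ne m 0 with rfl | hm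
      · exact absurd hse (not_isSEMinimallyPositive_hankelSeries_one h1)
      · refine (existsUnique_isRegularSolution_julia_iff (N := 2 * m) h0 h1).2 (ih
          (im_coeff_juliaSeries_eq_zero h1 fun k hk => hα k (by omega)) ?_)
        exact ((isJuliaPair_juliaSeries h1.ne').isSEMinimallyPositive_hankelSeries_iff h1 hm
          (fun k _ hk => hα k (by omega))).1 hse

/-- All Taylor coefficients of the solution are controlled, not only the prescribed ones: the
descent ends at a constant, with factorization of size `0`, and each augmentation adds one column.
Hence `q` counts the reductions. -/
theorem exists_hasHankelFactorization_of_isSEMinimallyPositive {f : ℍ → ℂ} {F : ℂ → ℂ}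
    (hα : ∀ k < 2 * m, (coeff k α).im = 0) (hse : IsSEMinimallyPositive (hankelSeries m α))
    (hf : IsPick f) (hF : AnalyticAt ℂ F x)
    (hfF : ∀ᶠ z in 𝓝 (x : ℂ), ∀ hz : 0 < z.im, F z = f ⟨z, hz⟩)
    (hc : ∀ k < 2 * m, coeff k (taylor F x) = coeff k α) :
    ∃ q < m, HasHankelFactorization (taylor F x) q := by
  induction m generalizing α f F with
  | zero => exact absurd (posDef_of_isEmpty _).posSemidef (hse.2 1 one_pos)
  | succ m ih =>
    have h0 := hα 0 (by omega)
    have hc0 : F x = coeff 0 α := by rw [← hc 0 (by omega), coeff_zero_taylor]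
    have hc1 : deriv F x = coeff 1 α := by rw [← hc 1 (by omega), coeff_one_taylor]
    rcases (coeff_one_nonneg_of_posSemidef hse.1).eq_or_lt with h1 | h1
    · refine ⟨0, by omega, fun _ => Fin.elim0, Fin.elim0, fun l => l.elim0, fun _ l => l.elim0,
        fun l => l.elim0, fun i j => ?_⟩
      rw [(hf.eq_const hF hfF (by rwa [hc0]) (by rw [hc1, h1])).2, coeff_C, if_neg (by omega)]
      simp
    · rcases eq_or_ne m 0 with rfl | hm
      · exact absurd hse (not_isSEMinimallyPositive_hankelSeries_one h1)
      have hne : deriv F x ≠ 0 := by rw [hc1]; exact h1.ne'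
      have hpα := isJuliaPair_juliaSeries h1.ne'
      obtain ⟨G, hG, hgG, hpair⟩ := exists_analytic_julia hF hfF hne
      have hp := hf.julia hF hfF (by rwa [hc0]) hne
      obtain ⟨q, hq, hfac⟩ := ih
        (im_coeff_juliaSeries_eq_zero h1 fun k hk => hα k (by omega))
        ((hpα.isSEMinimallyPositive_hankelSeries_iff h1 hm (fun k _ hk => hα k (by omega))).1 hse)
        hp hG hgG
        ((hpair.coeff_eq_iff hpα (hc 1 (by omega)) h1.ne' (hc 0 (by omega)) (2 * m)).1 hc)
      exact ⟨q + 1, by omega, hpair.hasHankelFactorization (by rwa [coeff_one_taylor]) hfac⟩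

/-- Descent along a solution: it either exhausts the data, reaching the empty matrix, or meets `α₁ =
0`, where the solution is constant and the remaining Hankel matrix is zero. -/
theorem posDef_or_isSEMinimallyPositive_of_exists (hα : ∀ k < 2 * m, (coeff k α).im = 0)
    (hex : ∃ f, IsRegularSolution x (2 * m) α f) :
    (hankelSeries m α).PosDef ∨ IsSEMinimallyPositive (hankelSeries m α) := by
  induction m generalizing α with
  | zero => exact Or.inl (posDef_of_isEmpty _)
  | succ m ih =>
    have h0 := hα 0 (by omega)
    obtain ⟨f, hf⟩ := hex
    rcases (IsRegularSolution.coeff_one_nonneg (N := 2 * m) hf h0).eq_or_lt with h1 | h1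
    · exact Or.inr (isSEMinimallyPositive_of_coeff_eq_zero
        (IsRegularSolution.eq_const (N := 2 * m) hf h0 h1.symm).2)
    · have hpα := isJuliaPair_juliaSeries h1.ne'
      have hr : ∀ k, 1 ≤ k → k ≤ m + 1 → (coeff k α).im = 0 := fun k _ hk => hα k (by omega)
      rw [hpα.posDef_hankelSeries_iff h1 hr]
      rcases eq_or_ne m 0 with rfl | hm
      · exact Or.inl (posDef_of_isEmpty _)
      · rw [hpα.isSEMinimallyPositive_hankelSeries_iff h1 hm hr]
        exact ih (im_coeff_juliaSeries_eq_zero h1 fun k hk => hα k (by omega))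
          ((exists_isRegularSolution_julia_iff (N := 2 * m) h0 h1).1 ⟨f, hf⟩)

end Hankel

/-! ### Removing the pole, and Laurent coefficients. -/

section Pole

open Complex

variable {x : ℝ} {f : ℍ → ℂ} {F : ℂ → ℂ}

theorem eventually_eq_nhdsNE_of_eventually_upper {F G : ℂ → ℂ} (hF : MeromorphicAt F x)
    (hG : MeromorphicAt G x) (h : ∀ᶠ z in 𝓝 (x : ℂ), 0 < z.im → F z = G z) :
    F =ᶠ[𝓝[≠] (x : ℂ)] G := by
  refine (hF.frequently_eq_iff_eventuallyEq hG).1 ?_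
  have h1 : Tendsto (fun s : ℝ => (x : ℂ) + s * I) (𝓝[>] 0) (𝓝[≠] (x : ℂ)) := by
    refine tendsto_nhdsWithin_iff.2 ⟨tendsto_add_mul_nhdsGT x I, ?_⟩
    filter_upwards [self_mem_nhdsWithin] with s hs
    have hs0 : (0 : ℝ) < s := hs
    simp [hs0.ne']
  refine h1.frequently (Eventually.frequently ?_)
  filter_upwards [(tendsto_add_mul_nhdsGT x I).eventually h, self_mem_nhdsWithin] with s hs hs0
  have hs0' : (0 : ℝ) < s := hs0
  exact hs (by simpa using hs0')

theorem eventually_upper_of_eventually_nhdsNE {p : ℂ → Prop}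
    (h : ∀ᶠ z in 𝓝[≠] (x : ℂ), p z) : ∀ᶠ z in 𝓝 (x : ℂ), 0 < z.im → p z := by
  filter_upwards [eventually_nhdsWithin_iff.1 h] with z hz hz0
  exact hz (sub_ne_zero.1 (sub_ofReal_ne_zero hz0 x))

/-- A Pick function that is meromorphic at a real point has at most a simple pole there, and
removing the polar part leaves a Pick function. -/
theorem IsPick.exists_sub_pole (hf : IsPick f) (hF : MeromorphicAt F x)
    (hfF : ∀ᶠ z in 𝓝 (x : ℂ), ∀ hz : 0 < z.im, F z = f ⟨z, hz⟩) :
    ∃ (s : ℂ) (G : ℂ → ℂ), AnalyticAt ℂ G x ∧ IsPick (fun z => f z + s * ((z : ℂ) - x)⁻¹) ∧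
      (∀ᶠ z in 𝓝 (x : ℂ), ∀ hz : 0 < z.im, G z = f ⟨z, hz⟩ + s * (z - x)⁻¹) ∧
      F =ᶠ[𝓝[≠] (x : ℂ)] fun z => G z - s * (z - x)⁻¹ := by
  rcases le_or_gt 0 (meromorphicOrderAt F (x : ℂ)) with ho | ho
  · obtain ⟨G, hG, hFG⟩ := hF.meromorphicOrderAt_nonneg_iff.1 ho
    refine ⟨0, G, hG, by simpa using hf, ?_, by simpa using hFG⟩
    filter_upwards [hfF, eventually_upper_of_eventually_nhdsNE hFG] with z h1 h2 hz
    rw [← h2 hz, h1 hz]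
    simp
  -- At a pole, `-1/f` is Pick and extends analytically by `0` to `x`, with nonzero derivative `d`
  -- since it is not constant. Its Julia reduction is `f + 1/(d(z - x))`, so `s = 1/d` and the pole
  -- is simple.
  · have hne : ∀ z, f z ≠ 0 := by
      intro w hw
      have hconst : ∀ z, f z = 0 := by
        intro z
        have := eq_const_of_im_eq_zero hf.differentiableOn (fun z _ => hf.im_nonneg _) w.im_pos
          (by simp [hw]) z.im_pos
        simpa [hw] using this
      have h0 := eventually_eq_nhdsNE_of_eventually_upper hF (MeromorphicAt.const 0 (x : ℂ))
        (hfF.mono fun z hz hz0 => by rw [hz hz0, hconst])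
      rw [meromorphicOrderAt_eq_top_iff.2 h0] at ho
      simp at ho
    have hinvo : 0 < meromorphicOrderAt F⁻¹ (x : ℂ) := by
      rw [meromorphicOrderAt_inv]
      cases h : meromorphicOrderAt F (x : ℂ) with
      | top => simp [h] at ho
      | coe k =>
        rw [h] at ho
        have hk : k < 0 := by exact_mod_cast ho
        have : (0 : ℤ) < -k := by omega
        exact_mod_cast this
    obtain ⟨h, hh, hFh⟩ := hF.inv.meromorphicOrderAt_nonneg_iff.1 hinvo.le
    have hh0 : h x = 0 := by
      have h1 := (tendsto_zero_of_meromorphicOrderAt_pos hinvo).congr' hFh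
      exact tendsto_nhds_unique (hh.continuousAt.tendsto.mono_left nhdsWithin_le_nhds) h1
    have hHa : AnalyticAt ℂ (fun z => -h z) x := hh.fun_neg
    have hp : IsPick (fun z => -(f z)⁻¹) := by
      have := IsPick.of_differentiableOn (φ := fun z => -(f (UpperHalfPlane.ofComplex z))⁻¹)
        (hf.differentiableOn.inv fun z _ => hne _).neg fun z _ => by
          rw [neg_im, inv_im, neg_div, neg_neg]
          exact div_nonneg (hf.im_nonneg _) (normSq_nonneg _)
      simpa using this
    have hag : ∀ᶠ z in 𝓝 (x : ℂ), ∀ hz : 0 < z.im, -h z = -(f ⟨z, hz⟩)⁻¹ := by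
      filter_upwards [hfF, eventually_upper_of_eventually_nhdsNE hFh] with z h1 h2 hz
      rw [← h2 hz, Pi.inv_apply, h1 hz]
    have hd : deriv (fun z => -h z) (x : ℂ) ≠ 0 := by
      intro hd
      have := congrFun (hp.eq_const hHa hag (by simp [hh0]) hd).1 UpperHalfPlane.I
      simp [hh0, hne] at this
    obtain ⟨G, hG, hgG, -⟩ := exists_analytic_julia (f := fun z => -(f z)⁻¹) hHa hag hd
    have hgp := hp.julia hHa hag (by simp [hh0]) hd
    simp only [hh0, neg_zero, sub_zero, inv_neg, inv_inv, neg_neg, mul_inv] at hgp hgG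
    refine ⟨_, G, hG, hgp, hgG, eventually_eq_nhdsNE_of_eventually_upper hF ?_ ?_⟩
    · have : MeromorphicAt (fun z : ℂ => z - x) x := by fun_prop
      exact hG.meromorphicAt.fun_sub ((MeromorphicAt.const _ _).fun_mul this.fun_inv)
    · filter_upwards [hfF, hgG] with z h1 h2 hz
      rw [h1 hz, h2 hz, add_sub_cancel_right]

open PowerSeries in
/-- Uniqueness of Laurent coefficients. -/
theorem IsLaurentExpansionAt.eq_taylor {x s : ℂ} {G : ℂ → ℂ} {c : ℤ → ℂ}
    (hc : IsLaurentExpansionAt F x c) (hG : AnalyticAt ℂ G x)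
    (hFG : F =ᶠ[𝓝[≠] x] fun z => G z - s * (z - x)⁻¹) :
    c (-1) = -s ∧ ∀ k : ℕ, c k = coeff k (taylor G x) := by
  obtain ⟨N, hN, hsum⟩ := hc
  set P : ℂ → ℂ := fun z => if z = x then c (-N) else (z - x) ^ N * F z with hP
  have hPs : ∀ᶠ z in 𝓝 x, HasSum (fun j : ℕ => c ((j : ℤ) - N) * (z - x) ^ j) (P z) := by
    filter_upwards [eventually_nhdsWithin_iff.1 hsum] with z hz
    by_cases hzx : z = x
    · subst hzx
      have : P z = c (((0 : ℕ) : ℤ) - N) * (z - z) ^ 0 := by simp [hP]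
      rw [this]
      exact hasSum_single 0 fun j hj => by simp [hj]
    · have h0 : z - x ≠ 0 := sub_ne_zero.2 hzx
      have h1 := (hz hzx).mul_left ((z - x) ^ N)
      have h2 : P z = (z - x) ^ N * F z := by simp [hP, hzx]
      rw [h2]
      refine h1.congr_fun fun j => ?_
      rw [zpow_sub₀ h0, zpow_natCast, zpow_natCast]
      field_simp
  have hPa : AnalyticAt ℂ P x := (hasFPowerSeriesAt_of_eventually_hasSum hPs).analyticAt
  have hPt := taylor_eq_mk_of_eventually_hasSum hPs
  have ht : AnalyticAt ℂ (fun z : ℂ => z - x) x := by fun_prop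
  have hQa : AnalyticAt ℂ (fun z => (z - x) * G z - s) x := by fun_prop
  have hev : (fun z => (z - x) * P z) =ᶠ[𝓝 x] fun z => (z - x) ^ N * ((z - x) * G z - s) := by
    refine ((ht.fun_mul hPa).frequently_eq_iff_eventually_eq ((ht.fun_pow N).fun_mul hQa)).1
      (Eventually.frequently ?_)
    filter_upwards [hFG, self_mem_nhdsWithin] with z hz hzx
    have hzx' : z ≠ x := hzx
    have h0 : z - x ≠ 0 := sub_ne_zero.2 hzx'
    have h2 : P z = (z - x) ^ N * F z := by simp [hP, hzx']
    rw [h2, hz]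
    field_simp
  -- The extra factor `X` clears the term `s * (z - x)⁻¹`, so both parts are read off one identity,
  -- at indices `N` and `k + 1 + N`.
  have hser : X * PowerSeries.mk (fun j : ℕ => c ((j : ℤ) - N)) =
      X ^ N * (X * taylor G x - C s) := by
    have := taylor_congr hev
    rwa [taylor_mul ht hPa, taylor_mul (ht.fun_pow N) hQa, taylor_pow ht,
      taylor_sub (ht.fun_mul hG) analyticAt_const, taylor_mul ht hG, taylor_const,
      taylor_sub_self, hPt] at this
  constructor
  · rcases N with _ | N
    · have := congrArg (coeff 0) hser
      rw [hN (-1) (by simp)]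
      simpa using this
    · have := congrArg (coeff (0 + (N + 1))) hser
      rw [coeff_X_pow_mul, zero_add, coeff_succ_X_mul] at this
      simpa using this
  · intro k
    have := congrArg (coeff (k + 1 + N)) hser
    rw [coeff_X_pow_mul, show k + 1 + N = (k + N) + 1 by ring, coeff_succ_X_mul, map_sub,
      coeff_succ_X_mul, coeff_C, if_neg (by omega)] at this
    simpa using this

open PowerSeries in
theorem isLaurentExpansionAt_add_pole {x b : ℂ} {G : ℂ → ℂ} (hG : AnalyticAt ℂ G x) :
    IsLaurentExpansionAt (fun z => G z + b * (z - x)⁻¹) x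
      (fun k => if k = -1 then b else if 0 ≤ k then coeff k.toNat (taylor G x) else 0) := by
  refine ⟨1, fun k hk => ?_, ?_⟩
  · simp only [Nat.cast_one] at hk
    simp only [show ¬ k = -1 by omega, show ¬ 0 ≤ k by omega, if_false]
  · refine eventually_nhdsWithin_of_eventually_nhds ?_
    filter_upwards [eventually_hasSum_taylor hG] with z hz
    have := (hasSum_nat_add_iff (f := fun j : ℕ => (if (j : ℤ) - (1 : ℕ) = -1 then b else
      if 0 ≤ (j : ℤ) - (1 : ℕ) then coeff ((j : ℤ) - (1 : ℕ)).toNat (taylor G x) else 0) *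
        (z - x) ^ ((j : ℤ) - (1 : ℕ))) 1 (g := G z)).1 ?_
    · simpa using this
    · refine hz.congr_fun fun j => ?_
      have h1 : (((j + 1 : ℕ) : ℤ) - (1 : ℕ)) = j := by push_cast; ring
      rw [h1, if_neg (by omega), if_pos (by omega), Int.toNat_natCast, zpow_natCast]

theorem isPick_add_pole {g : ℍ → ℂ} (hg : IsPick g) {b : ℂ} (hb : b ≤ 0) (x : ℝ) :
    IsPick (fun z => g z + b * ((z : ℂ) - x)⁻¹) := by
  obtain ⟨hre, him⟩ := Complex.le_def.1 hb
  simp only [zero_re, zero_im] at hre him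
  have := IsPick.of_differentiableOn (φ := fun z => g (UpperHalfPlane.ofComplex z) +
    b * (z - x)⁻¹) ?_ ?_
  · simpa using this
  · refine hg.differentiableOn.add (DifferentiableOn.const_mul (DifferentiableOn.inv
      (by fun_prop) fun z hz => sub_ofReal_ne_zero hz x) _)
  · intro z hz
    have h1 : (b * (z - x)⁻¹).im = -b.re * (z.im / normSq (z - x)) := by
      rw [mul_im, him, inv_im]
      simp
      ring
    rw [add_im, h1]
    have h2 := normSq_nonneg (z - x)
    have : 0 ≤ z.im / normSq (z - x) := by positivity
    have := hg.im_nonneg (UpperHalfPlane.ofComplex z)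
    have : 0 ≤ -b.re * (z.im / normSq (z - x)) := mul_nonneg (by linarith) (by assumption)
    linarith

/-- Removing the polar part, as a bijection. -/
noncomputable def subPoleEquiv (x : ℝ) (b : ℂ) : (ℍ → ℂ) ≃ (ℍ → ℂ) where
  toFun f z := f z - b * ((z : ℂ) - x)⁻¹
  invFun g z := g z + b * ((z : ℂ) - x)⁻¹
  left_inv f := by ext z; simp
  right_inv g := by ext z; simp

/-- Uniqueness of Laurent coefficients identifies the removed polar part with the prescribed one;
conversely, `a (-1) ≤ 0` makes the added pole a Pick function. -/
theorem isSolution_iff_isRegularSolution {n : ℕ} {a : ℤ → ℂ} (ha : a (-1) ≤ 0) :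
    IsSolution x n a f ↔ IsRegularSolution x (n + 1) (PowerSeries.mk fun k : ℕ => a k)
      (subPoleEquiv x (a (-1)) f) := by
  constructor
  · rintro ⟨hf, F, hF, hfF, c, hc, hca⟩
    obtain ⟨s, G, hG, hp, hgG, hFG⟩ := hf.exists_sub_pole hF hfF
    obtain ⟨hc1, hck⟩ := hc.eq_taylor hG hFG
    have hs : s = -a (-1) := by rw [← hca (-1) le_rfl (by omega), hc1, neg_neg]
    have he : subPoleEquiv x (a (-1)) f = fun z => f z + s * ((z : ℂ) - x)⁻¹ := by
      ext z
      simp [subPoleEquiv, hs, sub_eq_add_neg]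
    rw [he]
    refine ⟨hp, G, hG, hgG, fun k hk => ?_⟩
    rw [← hck, PowerSeries.coeff_mk, hca k (by omega) (by omega)]
  · rintro ⟨hg, G, hG, hgG, hc⟩
    rw [← (subPoleEquiv x (a (-1))).symm_apply_apply f]
    set g := subPoleEquiv x (a (-1)) f
    refine ⟨isPick_add_pole hg ha x, fun z => G z + a (-1) * (z - x)⁻¹, ?_, ?_, _,
      isLaurentExpansionAt_add_pole hG, ?_⟩
    · have : MeromorphicAt (fun z : ℂ => z - x) x := by fun_prop
      exact hG.meromorphicAt.fun_add ((MeromorphicAt.const _ _).fun_mul this.fun_inv)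
    · filter_upwards [hgG] with z hz hz0
      rw [hz hz0]
      rfl
    · intro k hk1 hk
      rcases eq_or_ne k (-1) with rfl | hk2
      · simp
      · obtain ⟨j, rfl⟩ := Int.eq_ofNat_of_zero_le (show 0 ≤ k by omega)
        rw [if_neg hk2, if_pos (by omega), Int.toNat_natCast, hc j (by omega),
          PowerSeries.coeff_mk]

end Pole

/-! ### The formula for the coefficient of index `2m`. -/

section LastCoefficient

open Matrix PowerSeries

theorem hankel_eq_hankelSeries (m : ℕ) (a : ℤ → ℂ) :
    hankel m a = hankelSeries m (PowerSeries.mk fun k : ℕ => a k) := by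
  ext i j
  simp [hankel, hankelSeries]

variable {τ : ℂ⟦X⟧} {q m : ℕ}

theorem hankelSeries_congr {α : ℂ⟦X⟧} (h : ∀ k < 2 * m, coeff k α = coeff k τ) :
    hankelSeries m α = hankelSeries m τ := by
  ext i j
  exact h _ (by omega)

theorem isUnit_factor {Z : ℕ → Fin q → ℂ} (hZ : ∀ (i : ℕ) (l : Fin q), i < l → Z i l = 0)
    (hZd : ∀ l : Fin q, Z l l ≠ 0) : IsUnit (Matrix.of fun i l : Fin q => Z i l) := by
  rw [Matrix.isUnit_iff_isUnit_det, Matrix.det_of_isLowerTriangular]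
  · exact (Finset.prod_ne_zero_iff.2 fun l _ => hZd l).isUnit
  · intro i j hij
    exact hZ i j hij

theorem hankelSeries_eq_mul {Z : ℕ → Fin q → ℂ} {d : Fin q → ℂ}
    (h : ∀ i j, coeff (i + j + 1) τ = ∑ l, Z i l * d l * Z j l) (p : ℕ) :
    hankelSeries p τ = (Matrix.of fun (i : Fin p) l => Z i l) * Matrix.diagonal d *
      (Matrix.of fun (i : Fin p) l => Z i l)ᵀ := by
  ext i j
  rw [hankelSeries, Matrix.of_apply, h, Matrix.mul_apply]
  simp

/-- Let `z_i` be the rows of the factor, `D` the diagonal, and `Q` the top `q × q` block, which is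
triangular and invertible. Then `H_q = Q D Qᵀ`, so `H_m` has rank `q`. The two vectors in the
formula are `Q D z_{m-1}` and `Q D z_m`, hence the right-hand side is `z_{m-1}ᵀ D z_m`, the
coefficient of index `(m - 1) + m + 1 = 2m`. -/
theorem lastCoeffCondition_iff_of_hasHankelFactorization (hqm : q < m)
    (hfac : HasHankelFactorization τ q) {a : ℤ → ℂ} (ha : ∀ k : ℕ, k < 2 * m → a k = coeff k τ) :
    LastCoeffCondition m a ↔ a (2 * (m : ℤ)) = coeff (2 * m) τ := by
  obtain ⟨Z, d, hd, hZ, hZd, hτ⟩ := hfac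
  set Q : Matrix (Fin q) (Fin q) ℂ := Matrix.of fun i l : Fin q => Z i l with hQ
  have hQu : IsUnit Q := isUnit_factor hZ hZd
  have hDu : IsUnit (Matrix.diagonal d) := by
    rw [Matrix.isUnit_iff_isUnit_det, Matrix.det_diagonal]
    exact (Finset.prod_ne_zero_iff.2 fun l _ => hd l).isUnit
  have hQtu : IsUnit Qᵀ := by
    rw [Matrix.isUnit_iff_isUnit_det, Matrix.det_transpose, ← Matrix.isUnit_iff_isUnit_det]
    exact hQu
  have hHq : hankelSeries q τ = Q * Matrix.diagonal d * Qᵀ := hankelSeries_eq_mul hτ q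
  have hHu : IsUnit (hankelSeries q τ) := by
    rw [hHq]
    exact (hQu.mul hDu).mul hQtu
  have hcongr : ∀ p ≤ m, hankel p a = hankelSeries p τ := by
    intro p hp
    rw [hankel_eq_hankelSeries]
    exact hankelSeries_congr fun k hk => by rw [coeff_mk, ha k (by omega)]
  have hrank : (hankel m a).rank = q := by
    rw [hcongr m le_rfl]
    refine le_antisymm ?_ ?_
    · rw [hankelSeries_eq_mul hτ m, Matrix.mul_assoc]
      exact (Matrix.rank_mul_le_left _ _).trans (Matrix.rank_le_width _)
    · have h1 := Matrix.rank_submatrix_le (hankelSeries m τ) (Fin.castLE hqm.le) (Fin.castLE hqm.le)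
      have h2 : (hankelSeries m τ).submatrix (Fin.castLE hqm.le) (Fin.castLE hqm.le) =
        hankelSeries q τ := rfl
      rwa [h2, Matrix.rank_of_isUnit _ hHu, Fintype.card_fin] at h1
  obtain ⟨m, rfl⟩ := Nat.exists_eq_add_of_le' (show 1 ≤ m by omega)
  have hu : (fun i : Fin q => a (((m + 1 : ℕ) : ℤ) + ((i : ℕ) : ℤ))) =
      Q *ᵥ fun l => d l * Z m l := by
    ext i
    have h1 : (((m + 1 : ℕ) : ℤ) + ((i : ℕ) : ℤ)) = ((i + m + 1 : ℕ) : ℤ) := by push_cast; ring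
    rw [h1, ha _ (by omega), hτ, Matrix.mulVec, dotProduct]
    simp [hQ, mul_assoc]
  have hv : (fun i : Fin q => a (((m + 1 : ℕ) : ℤ) + 1 + ((i : ℕ) : ℤ))) =
      Q *ᵥ (Matrix.diagonal d *ᵥ Z (m + 1)) := by
    ext i
    have h1 : (((m + 1 : ℕ) : ℤ) + 1 + ((i : ℕ) : ℤ)) = ((i + (m + 1) + 1 : ℕ) : ℤ) := by
      push_cast; ring
    rw [h1, ha _ (by omega), hτ, Matrix.mulVec, dotProduct]
    simp [hQ, mul_assoc, Matrix.mulVec_diagonal]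
  have hw : (hankel q a)⁻¹ *ᵥ (Q *ᵥ (Matrix.diagonal d *ᵥ Z (m + 1))) = Qᵀ⁻¹ *ᵥ Z (m + 1) := by
    rw [hcongr q (by omega), hHq]
    have h1 : Q *ᵥ (Matrix.diagonal d *ᵥ Z (m + 1)) =
        (Q * Matrix.diagonal d * Qᵀ) *ᵥ (Qᵀ⁻¹ *ᵥ Z (m + 1)) := by
      rw [Matrix.mulVec_mulVec, Matrix.mulVec_mulVec, Matrix.mul_assoc _ Qᵀ,
        Matrix.mul_nonsing_inv _ ((Matrix.isUnit_iff_isUnit_det _).1 hQtu), Matrix.mul_one]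
    rw [h1, Matrix.mulVec_mulVec, Matrix.nonsing_inv_mul _
      ((Matrix.isUnit_iff_isUnit_det _).1 (hHq ▸ hHu)), Matrix.one_mulVec]
  rw [LastCoeffCondition, hrank, hu, hv, hw]
  have hdot : (Q *ᵥ fun l => d l * Z m l) ⬝ᵥ (Qᵀ⁻¹ *ᵥ Z (m + 1)) =
      coeff (2 * (m + 1)) τ := by
    rw [← Matrix.vecMul_transpose, ← Matrix.dotProduct_mulVec, Matrix.mulVec_mulVec,
      Matrix.mul_nonsing_inv _ ((Matrix.isUnit_iff_isUnit_det _).1 hQtu), Matrix.one_mulVec,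
      show 2 * (m + 1) = m + (m + 1) + 1 by ring, hτ, dotProduct]
    exact Finset.sum_congr rfl fun l _ => by ring
  rw [hdot]

end LastCoefficient

/-! ### The first non-real coefficient. -/

section Rho

variable {n : ℕ} {a : ℤ → ℂ}

theorem rho_le {k : ℕ} (hk : k ≤ n) (h : (a k).im ≠ 0) : rho n a ≤ k :=
  iInf₂_le k ⟨hk, h⟩

theorem im_eq_zero_of_rho_eq_top (h : rho n a = ⊤) {k : ℕ} (hk : k ≤ n) : (a k).im = 0 := by
  by_contra h0
  have := rho_le hk h0
  rw [h] at this
  simp at this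

theorem of_rho_eq_natCast {k : ℕ} (h : rho n a = k) :
    k ≤ n ∧ (a k).im ≠ 0 ∧ ∀ j : ℕ, j < k → (a j).im = 0 := by
  have hmem : k ≤ n ∧ (a k).im ≠ 0 := by
    by_contra hk
    -- If `k` were not attained, every competing index would be at least `k + 1`.
    have h1 : ((k + 1 : ℕ) : ℕ∞) ≤ rho n a := by
      refine le_iInf₂ fun j hj => ?_
      have h2 := rho_le hj.1 hj.2
      rw [h] at h2
      have h3 : k ≤ j := by exact_mod_cast h2
      have h4 : k ≠ j := fun h4 => hk (h4 ▸ hj)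
      exact_mod_cast Nat.succ_le_of_lt (lt_of_le_of_ne h3 h4)
    rw [h] at h1
    have : k + 1 ≤ k := by exact_mod_cast h1
    omega
  refine ⟨hmem.1, hmem.2, fun j hj => ?_⟩
  by_contra h0
  have h1 := rho_le (hj.le.trans hmem.1) h0
  rw [h] at h1
  have : k ≤ j := by exact_mod_cast h1
  omega

end Rho

/-! ### Assembly of the four cases. -/

theorem theorem1p2 (x : ℝ) (n : ℕ) (hn : 1 ≤ n) (a : ℤ → ℂ)
    (ha_neg : a (-1) ≤ 0) (ha_zero : 0 ≤ (a 0).im) :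
    (∀ k : ℕ, Odd k → rho n a = (k : ℕ∞) → ¬ ∃ f, IsSolution x n a f) ∧
    (∀ m : ℕ, rho n a = ((2 * m : ℕ) : ℕ∞) →
      ((∃ f, IsSolution x n a f) ↔
        (hankel m a).PosDef ∧ 0 < (a (2 * (m : ℤ))).im)) ∧
    (rho n a = ⊤ → ∀ m : ℕ, n + 1 = 2 * m →
      ((∃ f, IsSolution x n a f) ↔
        (hankel m a).PosDef ∨ IsSEMinimallyPositive (hankel m a)) ∧
      ((∃! f, IsSolution x n a f) ↔ IsSEMinimallyPositive (hankel m a))) ∧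
    (rho n a = ⊤ → ∀ m : ℕ, n = 2 * m →
      ((∃ f, IsSolution x n a f) ↔
        (hankel m a).PosDef ∨
          (IsSEMinimallyPositive (hankel m a) ∧ LastCoeffCondition m a)) ∧
      ((∃! f, IsSolution x n a f) ↔
        IsSEMinimallyPositive (hankel m a) ∧ LastCoeffCondition m a)) := by
  set α : PowerSeries ℂ := PowerSeries.mk fun k : ℕ => a k with hα
  have hcoeff : ∀ k : ℕ, PowerSeries.coeff k α = a k := fun k => PowerSeries.coeff_mk k _
  have hH : ∀ m, hankel m a = hankelSeries m α := fun m => hankel_eq_hankelSeries m a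
  have hex : (∃ f, IsSolution x n a f) ↔ ∃ g, IsRegularSolution x (n + 1) α g :=
    (subPoleEquiv x (a (-1))).exists_congr fun _ => isSolution_iff_isRegularSolution ha_neg
  have hexu : (∃! f, IsSolution x n a f) ↔ ∃! g, IsRegularSolution x (n + 1) α g :=
    (subPoleEquiv x (a (-1))).existsUnique_congr fun _ => isSolution_iff_isRegularSolution ha_neg
  rw [hex, hexu]
  refine ⟨?_, ?_, ?_, ?_⟩
  · rintro k ⟨j, rfl⟩ hρ
    obtain ⟨h1, h2, h3⟩ := of_rho_eq_natCast hρ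
    exact not_exists_isRegularSolution_of_odd j (by omega)
      (fun k hk => by rw [hcoeff]; exact h3 k hk) (by rw [hcoeff]; exact h2)
  · intro m hρ
    obtain ⟨h1, h2, h3⟩ := of_rho_eq_natCast hρ
    have := exists_isRegularSolution_iff_of_even (x := x) (N := n + 1) (m := m) (α := α) (by omega)
      (fun k hk => by rw [hcoeff]; exact h3 k hk) (by rw [hcoeff]; exact h2)
    rw [this, hH, hcoeff]
    push_cast
    rfl
  · intro hρ m hm
    have hreal : ∀ k < 2 * m, (PowerSeries.coeff k α).im = 0 := fun k hk => by
      rw [hcoeff]; exact im_eq_zero_of_rho_eq_top hρ (by omega)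
    rw [hH, hm]
    have hnec := posDef_or_isSEMinimallyPositive_of_exists (x := x) hreal
    have hsuf := existsUnique_isRegularSolution_of_isSEMinimallyPositive (x := x) hreal
    have htwo := exists_ne_isRegularSolution_of_posDef (x := x) (Or.inl rfl) hreal
    refine ⟨⟨hnec, ?_⟩, ?_, hsuf⟩
    · rintro (h | h)
      · obtain ⟨f, -, -, hf, -⟩ := htwo h
        exact ⟨f, hf⟩
      · exact (hsuf h).exists
    · intro h
      refine (hnec h.exists).resolve_left fun hpd => ?_
      obtain ⟨f, g, hfg, hf, hg⟩ := htwo hpd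
      exact hfg (h.unique hf hg)
  · intro hρ m hm
    have hreal : ∀ k < 2 * m + 1, (PowerSeries.coeff k α).im = 0 := fun k hk => by
      rw [hcoeff]; exact im_eq_zero_of_rho_eq_top hρ (by omega)
    have hreal' : ∀ k < 2 * m, (PowerSeries.coeff k α).im = 0 := fun k hk => hreal k (by omega)
    rw [hH, hm]
    have hmono : ∀ f, IsRegularSolution x (2 * m + 1) α f → IsRegularSolution x (2 * m) α f :=
      fun f ⟨hf, F, hF, hfF, hc⟩ => ⟨hf, F, hF, hfF, fun k hk => hc k (by omega)⟩
    -- A function matching the first `2m` coefficients has its next one forced by the finite-rank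
    -- factorization, so `LastCoeffCondition` says exactly that the prescribed one agrees with it.
    have hlast : ∀ {f : ℍ → ℂ} {F : ℂ → ℂ}, IsSEMinimallyPositive (hankelSeries m α) → IsPick f →
        AnalyticAt ℂ F x → (∀ᶠ z in 𝓝 (x : ℂ), ∀ hz : 0 < z.im, F z = f ⟨z, hz⟩) →
        (∀ k < 2 * m, PowerSeries.coeff k (taylor F x) = PowerSeries.coeff k α) →
        (LastCoeffCondition m a ↔
          PowerSeries.coeff (2 * m) α = PowerSeries.coeff (2 * m) (taylor F x)) := by
      intro f F hse hf hF hfF hc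
      obtain ⟨q, hq, hfac⟩ :=
        exists_hasHankelFactorization_of_isSEMinimallyPositive hreal' hse hf hF hfF hc
      rw [lastCoeffCondition_iff_of_hasHankelFactorization hq hfac
        (fun k hk => by rw [hc k hk, hcoeff]), hcoeff]
      push_cast
      rfl
    have hnec : (∃ f, IsRegularSolution x (2 * m + 1) α f) → (hankelSeries m α).PosDef ∨
        (IsSEMinimallyPositive (hankelSeries m α) ∧ LastCoeffCondition m a) := by
      rintro ⟨f, hf⟩
      refine (posDef_or_isSEMinimallyPositive_of_exists hreal' ⟨f, hmono f hf⟩).imp_right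
        fun hse => ⟨hse, ?_⟩
      obtain ⟨hf, F, hF, hfF, hc⟩ := hf
      exact (hlast hse hf hF hfF fun k hk => hc k (by omega)).2 (hc _ (by omega)).symm
    have hsuf : (IsSEMinimallyPositive (hankelSeries m α) ∧ LastCoeffCondition m a) →
        ∃! f, IsRegularSolution x (2 * m + 1) α f := by
      rintro ⟨hse, hL⟩
      obtain ⟨f, hf, huniq⟩ :=
        existsUnique_isRegularSolution_of_isSEMinimallyPositive (x := x) hreal' hse
      refine ⟨f, ?_, fun g hg => huniq g (hmono g hg)⟩
      obtain ⟨hf, F, hF, hfF, hc⟩ := hf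
      refine ⟨hf, F, hF, hfF, fun k hk => ?_⟩
      rcases Nat.lt_succ_iff_lt_or_eq.1 hk with hk | rfl
      · exact hc k hk
      · exact ((hlast hse hf hF hfF hc).1 hL).symm
    have htwo := exists_ne_isRegularSolution_of_posDef (x := x) (Or.inr rfl) hreal
    refine ⟨⟨hnec, ?_⟩, ?_, hsuf⟩
    · rintro (h | h)
      · obtain ⟨f, -, -, hf, -⟩ := htwo h
        exact ⟨f, hf⟩
      · exact (hsuf h).exists
    · intro h
      refine (hnec h.exists).resolve_left fun hpd => ?_
      obtain ⟨f, g, hfg, hf, hg⟩ := htwo hpd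
      exact hfg (h.unique hf hg)
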